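/- **Setting.** Let $\Gamma$ be a circular $k$-gon ($k>1$): a closed strictly convex plane curve made of $k$ circular arcs $\Gamma_j$, listed counter-clockwise with indices modulo $k$, with centres $O_j\in\mathbb{C}\simeq\mathbb{R}^2$, radii $r_j>0$ with $r_j\ne r_{j+1}$, angular ranges $[a_j,b_j]\subset\mathbb{T}=\mathbb{R}/2\pi\mathbb{Z}$ and central angles $\delta_j>0$, where $b_j=a_j+\delta_j=a_{j+1}$, $\sum_{j=1}^k\delta_j=2\pi$ and $O_j+r_je^{ib_j}=O_{j+1}+r_{j+1}e^{ia_{j+1}}$. Its polar parametrisation is $z(\varphi)=O_j+r_je^{i\varphi}$ for $\varphi\in[a_j,b_j]$. Let $\mathcal{M}=\mathbb{T}\times[0,\pi]$ and let $f:\mathcal{M}\to\mathcal{M}$ be the billiard map: for $0<\theta<\pi$, $f(\varphi,\theta)=(\bar\varphi,\bar\theta)$, where $z(\bar\varphi)\neq z(\varphi)$ is the second intersection point with $\Gamma$ of the line $L$ through $z(\varphi)$ in the direction of the tangent at $z(\varphi)$ rotated counter-clockwise by $\theta$, and $\bar\theta\in(0,\pi)$ is the angle from $L$ to the tangent at $z(\bar\varphi)$;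 $f$ is the identity on $\partial\mathcal{M}$. **Oriented cells and stretching.** An oriented cell $\widetilde{\mathcal Q}$ is a homeomorphic image $\mathcal{Q}\subset\mathcal{M}$ of $[0,1]^2$ with four distinct boundary points (base-left, base-right, top-right, top-left) in counter-clockwise order; they split its boundary into base, right, top and left sides; base and top are the horizontal sides. A path $\gamma:[a,b]\to\mathcal{Q}$ is vertical in $\widetilde{\mathcal Q}$ if it connects the two horizontal sides and $\gamma(t)$ is in no horizontal side for $t\in(a,b)$. A map $g$ stretches $\widetilde{\mathcal Q}$ to $\widetilde{\mathcal Q}'$ along vertical paths, $g:\widetilde{\mathcal Q}\rightsquigarrow\widetilde{\mathcal Q}'$, if every path $\gamma$ vertical in $\widetilde{\mathcal Q}$ has a restriction $\gamma|_{[s,t]}$, $s<t$, such that $g\circ\gamma|_{[s,t]}$ is a path in $\mathcal Q'$ vertical in $\widetilde{\mathcal Q}'$. An oriented cell $\widetilde{\mathcal K}$ is a strict horizontal slab in $\widetilde{\mathcal Q}$ if $\mathcal K\subset\mathcal Q$, the left and right sides of $\widetilde{\mathcal K}$ are contained in the left and right (or in the right and left) sides of $\widetilde{\mathcal Q}$,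 respectively, and $\mathcal K$ does not meet the horizontal sides of $\widetilde{\mathcal Q}$. **Segments and quadrilaterals.** Let $\mathcal{L}_j=\{a_j\}\times[0,\pi]$ and, for $s>0$, $\mathcal{L}_j^{-s}=\{(\varphi,\theta)\in\mathcal M: a_{j-1}\le\varphi=a_j-2\theta s\}$, $\mathcal{L}_j^{s}=\{(\varphi,\theta)\in\mathcal M:\varphi=a_j+2\theta s\le a_{j+1}\}$. The extended singularity set is $\mathcal{L}=\bigcup_{j}\big(\mathcal{L}_j\cup\mathcal{L}_j^{1/2}\cup\mathcal{L}_j^1\big)$. For an integer $n\ge2$, $\widetilde{\mathcal Q}^-_{j,n}$ (respectively, $\widetilde{\mathcal Q}^+_{j,n}$) is the oriented cell bounded by $\mathcal{L}_j$ (left side), $\mathcal{L}_j^1$ (right side), $\mathcal{L}_{j+1}^{-n}$ (base) and $\mathcal{L}_{j+1}^{-n+1/2}$ (top) (respectively, by $\mathcal{L}_j$, $\mathcal{L}_j^1$, $\mathcal{L}_{j+1}^{-n+1/2}$ and $\mathcal{L}_{j+1}^{-n+1}$). **Constants.** Let $\mu_j=\sqrt{r_j/r_{j+1}}$, $\alpha_j^-=\dfrac{\delta_{j+1}}{\delta_j\max\{1,\mu_j\}}$,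 $\alpha_j^+=\dfrac{\delta_{j+1}}{\delta_j\min\{1,\mu_j\}}$, $\beta_j^\pm=\alpha_j^\pm+1$. For integers $\chi_j\ge2$, let $$\Upsilon_j=\{(n,n')\in\mathbb{N}^2:\alpha_j^-n+\beta_j^-\le n'\le\alpha_j^+n-\beta_j^+,\ n\ge\chi_j,\ n'\ge\chi_{j+1}\},$$ and let $\Xi_j$ be the set defined in the same way with $\alpha_j^-n+\beta_j^-<n'<\alpha_j^+n-\beta_j^+$. **Statement.** If the integers $\chi_j\ge 2$, $j$ mod $k$, are large enough (that is, $\chi_j\ge\chi^0_j$ for all $j$, for some integers $\chi^0_j$ that depend only on $\Gamma$), then the following hold. 1. (Fundamental Lemma) $f^n:\widetilde{\mathcal Q}^{\varsigma}_{j,n}\rightsquigarrow\widetilde{\mathcal Q}^{\varsigma'}_{j+1,n'}$ for all $j$ mod $k$, $(n,n')\in\Upsilon_j$ and $\varsigma,\varsigma'\in\{-,+\}$. 2. (Fundamental Corollary) There are pairwise disjoint strict horizontal slabs $\widetilde{\mathcal K}^{\varsigma}_{j,n}$ in $\widetilde{\mathcal Q}^{\varsigma}_{j,n}$, for all $j$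 mod $k$, $n\ge\chi_j$ and $\varsigma\in\{-,+\}$, such that, for all $j$ mod $k$, $(n,n')\in\Xi_j$ and $\varsigma,\varsigma'\in\{-,+\}$, (a) $f^n:\widetilde{\mathcal K}^{\varsigma}_{j,n}\rightsquigarrow\widetilde{\mathcal K}^{\varsigma'}_{j+1,n'}$; and (b) $f^n(\mathcal K^{\varsigma}_{j,n})\cap\mathcal K^{\varsigma'}_{j+1,n'}\cap\mathcal{L}=\emptyset$. -/

import Mathlib

open Set Topology

noncomputable section

namespace CircularBilliard

/-! ### The phase space and oriented cells -/

/-- The phase space: the cylinder `𝕋 × [0, π]` with `𝕋 = ℝ / 2πℤ`; points are `(φ, θ)`. -/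
abbrev Phase : Type := Real.Angle × Icc (0 : ℝ) Real.pi

/-- The unit square `[0,1]²`. -/
abbrev Square : Type := Icc (0 : ℝ) 1 × Icc (0 : ℝ) 1

namespace Square

/-- The unit square as a subset of the plane `ℂ = ℝ²`. -/
def toComplex (p : Square) : ℂ := ⟨p.1, p.2⟩

/-- The centre `(1/2, 1/2)` of the square. -/
def mid : Square := (⟨1 / 2, by norm_num, by norm_num⟩, ⟨1 / 2, by norm_num, by norm_num⟩)

def base : Set Square := {p | (p.2 : ℝ) = 0}
def top : Set Square := {p | (p.2 : ℝ) = 1}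
def left : Set Square := {p | (p.1 : ℝ) = 0}
def right : Set Square := {p | (p.1 : ℝ) = 1}

/-- The boundary of the square. -/
def boundary : Set Square := base ∪ right ∪ top ∪ left

end Square

/-- `H` lifts the map `h` from the square to the cylinder to a map from the square to the
universal cover, seen inside `ℂ = ℝ²` as `(φ, θ) ↦ φ + iθ`. -/
def IsLift (h : Square → Phase) (H : Square → ℂ) : Prop :=
  Continuous H ∧ ∀ p, (((H p).re : ℝ) : Real.Angle) = (h p).1 ∧ (H p).im = ((h p).2 : ℝ)

/-- The injective planar map `H` of the square carries the counter-clockwise orientation of the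
boundary of the square to the counter-clockwise orientation of its image: the loops
`H(p) - H(mid)` and `p - mid`, for `p` in the boundary of the square, have the same winding number
around `0`, that is, their quotient has a continuous logarithm. -/
def PreservesOrientation (H : Square → ℂ) : Prop :=
  ∃ l : Square → ℂ, ContinuousOn l Square.boundary ∧ ∀ p ∈ Square.boundary,
    H p - H Square.mid = Complex.exp (l p) * (p.toComplex - Square.mid.toComplex)

/-- An oriented cell: the homeomorphic image of the unit square in the cylinder, with four
distinct marked points on its boundary in counter-clockwise order. It is recorded through a
parametrisation by the square that takes the base-left, base-right, top-right and top-left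
corners of the square to the four marked points. (A continuous injection
of the compact square is a homeomorphism onto its image.) Only the underlying set
and the four sides of the cell are ever used. -/
structure OrientedCell where
  param : Square → Phase
  continuous_param : Continuous param
  injective_param : Function.Injective param
  oriented : ∃ H : Square → ℂ, IsLift param H ∧ PreservesOrientation H

namespace OrientedCell

variable (Q : OrientedCell)

/-- The underlying cell. -/
def carrier : Set Phase := range Q.param
/-- The base side. -/
def base : Set Phase := Q.param '' Square.base
/-- The top side. -/
def top : Set Phase := Q.param '' Square.top
/-- The left side. -/
def left : Set Phase := Q.param '' Square.left
/-- The right side. -/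
def right : Set Phase := Q.param '' Square.right
/-- The union of the two horizontal sides. -/
def horizontal : Set Phase := Q.base ∪ Q.top

end OrientedCell

/-- The path `γ : [a, b] → Q` is vertical in the oriented cell `Q`: it connects the two horizontal
sides of `Q` and does not meet them at intermediate times. -/
def IsVerticalPath (Q : OrientedCell) (γ : ℝ → Phase) (a b : ℝ) : Prop :=
  a < b ∧ ContinuousOn γ (Icc a b) ∧ (∀ t ∈ Icc a b, γ t ∈ Q.carrier) ∧
  ((γ a ∈ Q.base ∧ γ b ∈ Q.top) ∨ (γ a ∈ Q.top ∧ γ b ∈ Q.base)) ∧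
  ∀ t ∈ Ioo a b, γ t ∉ Q.horizontal

/-- `g` stretches `Q` to `Q'` along vertical paths. -/
def Stretches (g : Phase → Phase) (Q Q' : OrientedCell) : Prop :=
  ∀ (γ : ℝ → Phase) (a b : ℝ), IsVerticalPath Q γ a b →
    ∃ s t : ℝ, a ≤ s ∧ s < t ∧ t ≤ b ∧ IsVerticalPath Q' (g ∘ γ) s t

/-- `K` is a horizontal slab in `Q`. -/
def IsHorizontalSlab (K Q : OrientedCell) : Prop :=
  K.carrier ⊆ Q.carrier ∧
  ((K.left ⊆ Q.left ∧ K.right ⊆ Q.right) ∨ (K.left ⊆ Q.right ∧ K.right ⊆ Q.left))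

/-- `K` is a strict horizontal slab in `Q`. -/
def IsStrictHorizontalSlab (K Q : OrientedCell) : Prop :=
  IsHorizontalSlab K Q ∧ Disjoint K.carrier Q.horizontal

/-! ### Circular polygons -/

/-- The point `e^{iφ}`, for an angle `φ`. -/
def expi (φ : Real.Angle) : ℂ := (φ.toCircle : ℂ)

/-- A circular `k`-gon: a closed strictly convex curve in the plane `ℂ`, `C¹` but not `C²` at its
nodes, made of `k > 1` circular arcs, listed counter-clockwise. The `j`-th arc has centre `O j`,
radius `r j` and angular range `[a j, a j + δ j]`, with `a (j + 1) = a j + δ j`, because consecutive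
arcs have the same oriented tangent at their common node. The indices are taken modulo `k`. -/
structure CircularPolygon (k : ℕ) [NeZero k] where
  O : ZMod k → ℂ
  r : ZMod k → ℝ
  a : ZMod k → Real.Angle
  δ : ZMod k → ℝ
  one_lt : 1 < k
  r_pos : ∀ j, 0 < r j
  δ_pos : ∀ j, 0 < δ j
  /-- the tangent turns exactly once -/
  sum_δ : ∑ j, δ j = 2 * Real.pi
  /-- the oriented tangents agree at each node -/
  a_succ : ∀ j, a (j + 1) = a j + (δ j : Real.Angle)
  /-- the curvature jumps at each node -/
  r_ne : ∀ j, r j ≠ r (j + 1)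
  /-- the endpoint of each arc is the beginning of the next one -/
  node_eq : ∀ j, O j + r j * expi (a (j + 1)) = O (j + 1) + r (j + 1) * expi (a (j + 1))

namespace CircularPolygon

variable {k : ℕ} [NeZero k] (Γ : CircularPolygon k)

/-- `φ` lies in the angular range `[a j, b j]` of the `j`-th arc. -/
def InArc (φ : Real.Angle) (j : ZMod k) : Prop :=
  ∃ t : ℝ, 0 ≤ t ∧ t ≤ Γ.δ j ∧ φ = Γ.a j + (t : Real.Angle)

/-- The polar parametrisation `z(φ) = O j + r j e^{iφ}` for `φ` in the `j`-th angular range;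
see `z_eq`. -/
def z (φ : Real.Angle) : ℂ :=
  let j : ZMod k := Classical.epsilon fun j => Γ.InArc φ j
  Γ.O j + Γ.r j * expi φ

/-- Partial sums of the central angles. -/
def partialAngle (m : ℕ) : ℝ := ∑ l ∈ Finset.range m, Γ.δ (l : ZMod k)

lemma partialAngle_succ (m : ℕ) :
    Γ.partialAngle (m + 1) = Γ.partialAngle m + Γ.δ (m : ZMod k) :=
  Finset.sum_range_succ _ _

lemma partialAngle_mono : StrictMono Γ.partialAngle :=
  strictMono_nat_of_lt_succ fun m => by
    rw [partialAngle_succ]; linarith [Γ.δ_pos (m : ZMod k)]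

lemma partialAngle_zero : Γ.partialAngle 0 = 0 := rfl

lemma partialAngle_card : Γ.partialAngle k = 2 * Real.pi := by
  rw [← Γ.sum_δ, partialAngle]
  refine Finset.sum_bij (fun m _ => (m : ZMod k)) (fun _ _ => Finset.mem_univ _) ?_ ?_ ?_
  · intro x hx y hy h
    have := congrArg ZMod.val h
    rwa [ZMod.val_cast_of_lt (Finset.mem_range.1 hx),
      ZMod.val_cast_of_lt (Finset.mem_range.1 hy)] at this
  · intro j _
    exact ⟨j.val, Finset.mem_range.2 (ZMod.val_lt j), ZMod.natCast_zmod_val j⟩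
  · intro _ _; rfl

lemma a_natCast (m : ℕ) :
    Γ.a (m : ZMod k) = Γ.a 0 + (Γ.partialAngle m : Real.Angle) := by
  induction m with
  | zero => simp [partialAngle]
  | succ m ih =>
    rw [Nat.cast_succ, Γ.a_succ, ih, partialAngle_succ, Real.Angle.coe_add, add_assoc]

lemma exists_inArc (φ : Real.Angle) : ∃ j, Γ.InArc φ j := by
  obtain ⟨x, hx⟩ : ∃ x : ℝ, (x : Real.Angle) = φ - Γ.a 0 := by
    induction φ - Γ.a 0 using Real.Angle.induction_on with
    | h x => exact ⟨x, rfl⟩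
  set y := toIcoMod Real.two_pi_pos 0 x with hy
  have hyI : y ∈ Ico (0 : ℝ) (0 + 2 * Real.pi) := toIcoMod_mem_Ico Real.two_pi_pos 0 x
  have hyx : (y : Real.Angle) = (x : Real.Angle) := Real.Angle.coe_toIcoMod x 0
  have hex : ∃ m, y < Γ.partialAngle (m + 1) := by
    refine ⟨k, ?_⟩
    have := Γ.partialAngle_mono (Nat.lt_succ_self k)
    rw [Nat.succ_eq_add_one, Γ.partialAngle_card] at this
    linarith [hyI.2]
  classical
  have h1 := Nat.find_spec hex
  set m := Nat.find hex with hm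
  have h2 : Γ.partialAngle m ≤ y := by
    rcases Nat.eq_zero_or_pos m with h0 | h0
    · rw [h0, partialAngle_zero]; exact hyI.1
    · have := Nat.find_min hex (m := m - 1) (by omega)
      rw [Nat.sub_add_cancel h0] at this
      exact not_lt.1 this
  refine ⟨(m : ZMod k), y - Γ.partialAngle m, by linarith, ?_, ?_⟩
  · rw [partialAngle_succ] at h1; linarith
  · rw [a_natCast, Real.Angle.coe_sub, hyx, hx]; abel

lemma node_consistent {φ : Real.Angle} {i j : ZMod k} (hij : i.val ≤ j.val)
    (hi : Γ.InArc φ i) (hj : Γ.InArc φ j) :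
    Γ.O i + Γ.r i * expi φ = Γ.O j + Γ.r j * expi φ := by
  rcases hij.eq_or_lt with h | hlt
  · rw [ZMod.val_injective k h]
  obtain ⟨t, ht0, ht1, ht⟩ := hi
  obtain ⟨u, hu0, hu1, hu⟩ := hj
  have ei : ((i.val : ℕ) : ZMod k) = i := ZMod.natCast_zmod_val i
  have ej : ((j.val : ℕ) : ZMod k) = j := ZMod.natCast_zmod_val j
  have si := Γ.partialAngle_succ i.val
  have sj := Γ.partialAngle_succ j.val
  rw [ei] at si
  rw [ej] at sj
  have m1 : Γ.partialAngle (i.val + 1) ≤ Γ.partialAngle j.val :=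
    Γ.partialAngle_mono.monotone hlt
  have m2 : Γ.partialAngle (j.val + 1) ≤ Γ.partialAngle k :=
    Γ.partialAngle_mono.monotone (ZMod.val_lt j)
  have m0 : 0 ≤ Γ.partialAngle i.val := Γ.partialAngle_mono.monotone (Nat.zero_le _)
  have hk := Γ.partialAngle_card
  have ai := Γ.a_natCast i.val
  have aj := Γ.a_natCast j.val
  rw [ei] at ai
  rw [ej] at aj
  have key : ((Γ.partialAngle j.val + u : ℝ) : Real.Angle)
      = ((Γ.partialAngle i.val + t : ℝ) : Real.Angle) := by
    have := ht.symm.trans hu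
    rw [ai, aj, add_assoc, add_assoc, add_right_inj] at this
    rw [Real.Angle.coe_add, Real.Angle.coe_add]; exact this.symm
  obtain ⟨n, hn⟩ := Real.Angle.angle_eq_iff_two_pi_dvd_sub.1 key
  have hpi := Real.pi_pos
  have hn0 : (0 : ℝ) ≤ n := by
    by_contra hc
    push Not at hc
    nlinarith
  have hn1 : (n : ℝ) ≤ 1 := by
    by_contra hc
    push Not at hc
    nlinarith
  have hn0' : 0 ≤ n := by exact_mod_cast hn0
  have hn1' : n ≤ 1 := by exact_mod_cast hn1
  have hcases : n = 0 ∨ n = 1 := by omega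
  rcases hcases with rfl | rfl
  · simp only [Int.cast_zero, mul_zero] at hn
    have e : Γ.partialAngle (i.val + 1) = Γ.partialAngle j.val := by linarith
    have hv := Γ.partialAngle_mono.injective e
    have hj1 : j = i + 1 := by rw [← ej, ← hv, Nat.cast_add, ei, Nat.cast_one]
    have hu' : u = 0 := by linarith
    have hφ : φ = Γ.a (i + 1) := by rw [hu, hu', hj1, Real.Angle.coe_zero, add_zero]
    rw [hφ, hj1]; exact Γ.node_eq i
  · simp only [Int.cast_one, mul_one] at hn
    have e : Γ.partialAngle (j.val + 1) = Γ.partialAngle k := by linarith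
    have hv := Γ.partialAngle_mono.injective e
    have e0 : Γ.partialAngle i.val = Γ.partialAngle 0 := by
      rw [partialAngle_zero]; linarith
    have hv0 := Γ.partialAngle_mono.injective e0
    have hi0 : i = j + 1 := by
      rw [← ei, hv0, ← ej]
      have : ((j.val + 1 : ℕ) : ZMod k) = 0 := by rw [hv]; exact ZMod.natCast_self k
      rw [Nat.cast_zero, ← this, Nat.cast_add, Nat.cast_one]
    have ht' : t = 0 := by
      rw [partialAngle_zero] at e0; linarith
    have hφ : φ = Γ.a (j + 1) := by rw [ht, ht', hi0, Real.Angle.coe_zero, add_zero]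
    rw [hφ, hi0]; exact (Γ.node_eq j).symm

/-- The polar parametrisation is well defined. -/
theorem z_eq {φ : Real.Angle} {j : ZMod k} (hj : Γ.InArc φ j) :
    Γ.z φ = Γ.O j + Γ.r j * expi φ := by
  have h := Classical.epsilon_spec (Γ.exists_inArc φ)
  rcases le_total (Classical.epsilon fun j => Γ.InArc φ j).val j.val with h' | h'
  · exact Γ.node_consistent h' h hj
  · exact (Γ.node_consistent h' hj h).symm

/-! ### The billiard map -/

/-- The unit tangent vector at `z(φ)` in the counter-clockwise direction. -/
def tangent (φ : Real.Angle) : ℂ := Complex.I * expi φ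

/-- The direction of the outgoing trajectory at `(φ, θ)`: the tangent vector rotated by the
angle `θ` counter-clockwise. -/
def direction (x : Phase) : ℂ := expi ((x.2 : ℝ) : Real.Angle) * tangent x.1

/-- `y = (φ', θ')` is the next impact after `x = (φ, θ)`: `z(φ')` is another point of the
curve on the line through `z(φ)` in the direction of the trajectory, and `θ' ∈ (0, π)` is the angle
from that line to the tangent at `z(φ')` in the counter-clockwise direction. -/
def IsNextImpact (x y : Phase) : Prop :=
  Γ.z y.1 ≠ Γ.z x.1 ∧ (∃ c : ℝ, Γ.z y.1 = Γ.z x.1 + c * direction x) ∧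
  (0 < (y.2 : ℝ) ∧ (y.2 : ℝ) < Real.pi) ∧
  tangent y.1 = expi ((y.2 : ℝ) : Real.Angle) * direction x

open Classical in
/-- The billiard map on the cylinder; it fixes the points of the two boundary circles. (By strict
convexity, each interior point has exactly one next impact.) -/
def billiardMap (x : Phase) : Phase :=
  if h : (0 < (x.2 : ℝ) ∧ (x.2 : ℝ) < Real.pi) ∧ ∃ y, Γ.IsNextImpact x y then h.2.choose else x

/-! ### Singularity segments and fundamental quadrilaterals -/

/-- The vertical singularity segment `{a j} × [0, π]`. -/
def singSegment (j : ZMod k) : Set Phase := {x | x.1 = Γ.a j}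

/-- The slanted segment `a (j-1) ≤ φ = a j - 2θs`. -/
def backwardSegment (j : ZMod k) (s : ℝ) : Set Phase :=
  {x | x.1 = Γ.a j - ((2 * x.2 * s : ℝ) : Real.Angle) ∧ 2 * x.2 * s ≤ Γ.δ (j - 1)}

/-- The slanted segment `φ = a j + 2θs ≤ a (j+1)`. -/
def forwardSegment (j : ZMod k) (s : ℝ) : Set Phase :=
  {x | x.1 = Γ.a j + ((2 * x.2 * s : ℝ) : Real.Angle) ∧ 2 * x.2 * s ≤ Γ.δ j}

/-- The extended singularity set. -/
def extendedSingularSet : Set Phase :=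
  ⋃ j, Γ.singSegment j ∪ Γ.forwardSegment j (1 / 2) ∪ Γ.forwardSegment j 1

lemma δ_le_two_pi (j : ZMod k) : Γ.δ j ≤ 2 * Real.pi := by
  rw [← Γ.sum_δ]
  exact Finset.single_le_sum (fun i _ => (Γ.δ_pos i).le) (Finset.mem_univ j)

/-- The value `s = s₁ - (s₁ - s₀) v` at the point `(u, v)` of the square. -/
def level (s₀ s₁ : ℝ) (p : Square) : ℝ := s₁ - (s₁ - s₀) * p.2

lemma level_ge {s₀ s₁ : ℝ} (h : s₀ < s₁) (p : Square) : s₀ ≤ level s₀ s₁ p := by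
  unfold level
  nlinarith [p.2.2.1, p.2.2.2]

/-- The lift to the plane of the parametrisation of the quadrilateral: `(u, v)` goes to the point
with `φ = a j + 2θu = a (j+1) - 2θs`, where `s = s₁ - (s₁ - s₀) v`. -/
def quadLift (j : ZMod k) (s₀ s₁ : ℝ) (p : Square) : ℂ :=
  ⟨(Γ.a j).toReal + Γ.δ j * p.1 / (level s₀ s₁ p + p.1), Γ.δ j / (2 * (level s₀ s₁ p + p.1))⟩

def quadParam (j : ZMod k) (s₀ s₁ : ℝ) (h₀ : 1 ≤ s₀) (h₁ : s₀ < s₁) (p : Square) : Phase :=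
  (Γ.a j + ((Γ.δ j * p.1 / (level s₀ s₁ p + p.1) : ℝ) : Real.Angle),
   ⟨Γ.δ j / (2 * (level s₀ s₁ p + p.1)), by
      have h := level_ge h₁ p
      have hu := p.1.2.1
      have hpos : 0 < 2 * (level s₀ s₁ p + p.1) := by linarith
      refine ⟨div_nonneg (Γ.δ_pos j).le hpos.le, ?_⟩
      rw [div_le_iff₀ hpos]
      nlinarith [Γ.δ_le_two_pi j, Real.pi_pos]⟩)

lemma continuous_level (s₀ s₁ : ℝ) : Continuous (level s₀ s₁) := by
  unfold level; fun_prop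

lemma level_add_pos {s₀ s₁ : ℝ} (h₀ : 1 ≤ s₀) (h₁ : s₀ < s₁) (p : Square) :
    0 < level s₀ s₁ p + p.1 := by
  linarith [level_ge h₁ p, p.1.2.1]

/-- Along a segment in the square, the difference of two values of the lift is never a negative
multiple of the difference of the two points. -/
lemma quadLift_mem_slitPlane (j : ZMod k) {s₀ s₁ : ℝ} (h₀ : 1 ≤ s₀) (h₁ : s₀ < s₁) {p q : Square}
    (hpq : p ≠ q) :
    (Γ.quadLift j s₀ s₁ p - Γ.quadLift j s₀ s₁ q) / (p.toComplex - q.toComplex)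
      ∈ Complex.slitPlane := by
  have hδ := Γ.δ_pos j
  have hP := level_add_pos h₀ h₁ p
  have hQ := level_add_pos h₀ h₁ q
  have lp := level_ge h₁ p
  have lq := level_ge h₁ q
  have up := p.1.2.1
  have uq := q.1.2.1
  have hl : level s₀ s₁ p - level s₀ s₁ q = -(s₁ - s₀) * (p.2 - q.2) := by unfold level; ring
  have hs : 0 < s₁ - s₀ := by linarith
  have hne : p.toComplex - q.toComplex ≠ 0 := by
    intro h
    apply hpq
    have h' := sub_eq_zero.1 h
    have h1 := congrArg Complex.re h'
    have h2 := congrArg Complex.im h'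
    exact Prod.ext (Subtype.ext h1) (Subtype.ext h2)
  rw [Complex.mem_slitPlane_iff_not_le_zero]
  intro hle
  set w := (Γ.quadLift j s₀ s₁ p - Γ.quadLift j s₀ s₁ q) / (p.toComplex - q.toComplex) with hw
  obtain ⟨hre, him⟩ := Complex.le_def.1 hle
  simp only [Complex.zero_re, Complex.zero_im] at hre him
  have hmul : Γ.quadLift j s₀ s₁ p - Γ.quadLift j s₀ s₁ q = w * (p.toComplex - q.toComplex) := by
    rw [hw, div_mul_cancel₀ _ hne]
  have e1 := congrArg Complex.re hmul
  have e2 := congrArg Complex.im hmul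
  simp only [quadLift, Square.toComplex, Complex.sub_re, Complex.sub_im, Complex.mul_re,
    Complex.mul_im, him, zero_mul, sub_zero, add_zero] at e1 e2
  set u : ℝ := (p.1 : ℝ)
  set u' : ℝ := (q.1 : ℝ)
  set v : ℝ := (p.2 : ℝ)
  set v' : ℝ := (q.2 : ℝ)
  set a := level s₀ s₁ p
  set b := level s₀ s₁ q
  have f1 : Γ.δ j * u / (a + u) - Γ.δ j * u' / (b + u') = w.re * (u - u') := by
    rw [← e1]; ring
  rw [div_sub_div _ _ hP.ne' hQ.ne', div_eq_iff (mul_pos hP hQ).ne'] at f1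
  have hP2 : 2 * (a + u) ≠ 0 := by positivity
  have hQ2 : 2 * (b + u') ≠ 0 := by positivity
  rw [div_sub_div _ _ hP2 hQ2, div_eq_iff (mul_ne_zero hP2 hQ2)] at e2
  have hPQ := mul_pos hP hQ
  set P := (a + u) * (b + u') with hPdef
  have g1 : Γ.δ j * (b * (u - u') + u' * (b - a)) = w.re * (u - u') * P := by
    rw [← f1]; ring
  have g2 : Γ.δ j * ((b - a) - (u - u')) = 2 * (w.re * (v - v') * P) := by
    rw [hPdef]; linear_combination e2 / 2
  have hba : b - a = (s₁ - s₀) * (v - v') := by linarith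
  rw [hba] at g1 g2
  have hb : 0 < b := by linarith
  have hnn : 0 ≤ -w.re * P := mul_nonneg (by linarith) hPQ.le
  -- write `x = u - u'`, `y = v - v'`
  have g1' : Γ.δ j * (b * (u - u') + u' * ((s₁ - s₀) * (v - v')))
      = -((-w.re * P) * (u - u')) := by rw [g1]; ring
  have g2' : Γ.δ j * ((s₁ - s₀) * (v - v') - (u - u'))
      = -(2 * ((-w.re * P) * (v - v'))) := by rw [g2]; ring
  generalize -w.re * P = c at hnn g1' g2'
  have key1 : (Γ.δ j * b + c) * (u - u') = -(Γ.δ j * u' * (s₁ - s₀)) * (v - v') := by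
    linear_combination g1'
  have key2 : (Γ.δ j * (s₁ - s₀) + 2 * c) * (v - v') = Γ.δ j * (u - u') := by
    linear_combination g2'
  have hA : 0 < Γ.δ j * b + c := by positivity
  have hB : 0 < Γ.δ j * (s₁ - s₀) + 2 * c := by positivity
  have hC : 0 ≤ Γ.δ j * u' * (s₁ - s₀) := by positivity
  have hv : ((Γ.δ j * b + c) * (Γ.δ j * (s₁ - s₀) + 2 * c)
      + Γ.δ j * (Γ.δ j * u' * (s₁ - s₀))) * (v - v') = 0 := by
    linear_combination (Γ.δ j * b + c) * key2 + Γ.δ j * key1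
  have hv0 : v - v' = 0 := by
    rcases mul_eq_zero.1 hv with h | h
    · exfalso
      have : 0 < (Γ.δ j * b + c) * (Γ.δ j * (s₁ - s₀) + 2 * c) := mul_pos hA hB
      have : 0 ≤ Γ.δ j * (Γ.δ j * u' * (s₁ - s₀)) := mul_nonneg hδ.le hC
      linarith
    · exact h
  have hu0 : u - u' = 0 := by
    rw [hv0, mul_zero] at key1
    exact (mul_eq_zero.1 key1).resolve_left hA.ne'
  apply hne
  apply Complex.ext
  · simpa [Square.toComplex] using hu0
  · simpa [Square.toComplex] using hv0

lemma continuous_quadLift (j : ZMod k) {s₀ s₁ : ℝ} (h₀ : 1 ≤ s₀) (h₁ : s₀ < s₁) :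
    Continuous (Γ.quadLift j s₀ s₁) := by
  have hc := continuous_level s₀ s₁
  have hre : Continuous fun p : Square =>
      (Γ.a j).toReal + Γ.δ j * p.1 / (level s₀ s₁ p + p.1) := by
    refine continuous_const.add (Continuous.div (by fun_prop) (by fun_prop) ?_)
    exact fun p => (level_add_pos h₀ h₁ p).ne'
  have him : Continuous fun p : Square => Γ.δ j / (2 * (level s₀ s₁ p + p.1)) := by
    refine Continuous.div (by fun_prop) (by fun_prop) ?_
    exact fun p => (mul_pos two_pos (level_add_pos h₀ h₁ p)).ne'
  have := Complex.equivRealProdCLM.symm.continuous.comp (hre.prodMk him)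
  exact this

lemma quadParam_injective (j : ZMod k) {s₀ s₁ : ℝ} (h₀ : 1 ≤ s₀) (h₁ : s₀ < s₁) :
    Function.Injective (Γ.quadParam j s₀ s₁ h₀ h₁) := by
  intro p q h
  by_contra hpq
  have hs := Γ.quadLift_mem_slitPlane j h₀ h₁ hpq
  have bound : ∀ x : Square, 0 ≤ Γ.δ j * x.1 / (level s₀ s₁ x + x.1) ∧
      Γ.δ j * x.1 / (level s₀ s₁ x + x.1) ≤ Γ.δ j / 2 := by
    intro x
    have hP := level_add_pos h₀ h₁ x
    have hx := x.1.2.1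
    refine ⟨div_nonneg (mul_nonneg (Γ.δ_pos j).le hx) hP.le, ?_⟩
    rw [div_le_iff₀ hP]
    nlinarith [level_ge h₁ x, x.1.2.2, Γ.δ_pos j]
  have h1 := congrArg Prod.fst h
  have h2 := congrArg (fun x : Phase => (x.2 : ℝ)) h
  simp only [quadParam, add_right_inj] at h1 h2
  obtain ⟨n, hn⟩ := Real.Angle.angle_eq_iff_two_pi_dvd_sub.1 h1
  have hδ := Γ.δ_le_two_pi j
  have hpi := Real.pi_pos
  have b1 := bound p
  have b2 := bound q
  have hn0 : n = 0 := by
    have l1 : (-1 : ℝ) < n := by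
      by_contra hc
      push Not at hc
      nlinarith
    have l2 : (n : ℝ) < 1 := by
      by_contra hc
      push Not at hc
      nlinarith
    have l1' : -1 < n := by exact_mod_cast l1
    have l2' : n < 1 := by exact_mod_cast l2
    omega
  rw [hn0, Int.cast_zero, mul_zero] at hn
  have : Γ.quadLift j s₀ s₁ p - Γ.quadLift j s₀ s₁ q = 0 := by
    apply Complex.ext
    · simp only [quadLift, Complex.sub_re, Complex.zero_re]; linarith
    · simp only [quadLift, Complex.sub_im, Complex.zero_im]; linarith
  rw [this, zero_div] at hs
  exact Complex.zero_notMem_slitPlane hs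

lemma quadParam_isLift (j : ZMod k) {s₀ s₁ : ℝ} (h₀ : 1 ≤ s₀) (h₁ : s₀ < s₁) :
    IsLift (Γ.quadParam j s₀ s₁ h₀ h₁) (Γ.quadLift j s₀ s₁) := by
  refine ⟨Γ.continuous_quadLift j h₀ h₁, fun p => ⟨?_, rfl⟩⟩
  simp only [quadLift, quadParam, Real.Angle.coe_add, Real.Angle.coe_toReal]

lemma quadParam_continuous (j : ZMod k) {s₀ s₁ : ℝ} (h₀ : 1 ≤ s₀) (h₁ : s₀ < s₁) :
    Continuous (Γ.quadParam j s₀ s₁ h₀ h₁) := by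
  obtain ⟨hc, hl⟩ := Γ.quadParam_isLift j h₀ h₁
  refine Continuous.prodMk ?_ (Continuous.subtype_mk ?_ _)
  · have : Continuous fun p => (((Γ.quadLift j s₀ s₁ p).re : ℝ) : Real.Angle) :=
      Real.Angle.continuous_coe.comp (Complex.continuous_re.comp hc)
    exact this.congr fun p => (hl p).1
  · exact Complex.continuous_im.comp hc

lemma quadLift_preservesOrientation (j : ZMod k) {s₀ s₁ : ℝ} (h₀ : 1 ≤ s₀) (h₁ : s₀ < s₁) :
    PreservesOrientation (Γ.quadLift j s₀ s₁) := by
  have hmid : ∀ p ∈ Square.boundary, p ≠ Square.mid := by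
    rintro p hp rfl
    simp only [Square.boundary, Square.base, Square.right, Square.top, Square.left, Square.mid,
      mem_union, mem_ofPred_eq] at hp
    norm_num at hp
  have hsub : ∀ p ∈ Square.boundary, p.toComplex - Square.mid.toComplex ≠ 0 := by
    intro p hp h
    apply hmid p hp
    have h' := sub_eq_zero.1 h
    exact Prod.ext (Subtype.ext (congrArg Complex.re h')) (Subtype.ext (congrArg Complex.im h'))
  have hct : Continuous Square.toComplex := by
    have h : Continuous fun p : Square => ((p.1 : ℝ), (p.2 : ℝ)) := by fun_prop
    exact Complex.equivRealProdCLM.symm.continuous.comp h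
  refine ⟨fun p => Complex.log ((Γ.quadLift j s₀ s₁ p - Γ.quadLift j s₀ s₁ Square.mid) /
    (p.toComplex - Square.mid.toComplex)), ?_, ?_⟩
  · refine ContinuousOn.clog ?_ fun p hp => Γ.quadLift_mem_slitPlane j h₀ h₁ (hmid p hp)
    exact ContinuousOn.div
      ((Γ.continuous_quadLift j h₀ h₁).sub continuous_const).continuousOn
      (hct.sub continuous_const).continuousOn hsub
  · intro p hp
    have h := Γ.quadLift_mem_slitPlane j h₀ h₁ (hmid p hp)
    rw [Complex.exp_log (Complex.slitPlane_ne_zero h), div_mul_cancel₀ _ (hsub p hp)]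

/-- The oriented quadrilateral between the singularity segments `{φ = a j}` (left side),
`φ = a (j+1) - 2θs₁` (base side), `φ = a j + 2θ` (right side) and
`φ = a (j+1) - 2θs₀` (top side), where `1 ≤ s₀ < s₁`;
see `quadCell_carrier`, `quadCell_left` and the similar facts for the other sides. -/
def quadCell (j : ZMod k) (s₀ s₁ : ℝ) (h₀ : 1 ≤ s₀) (h₁ : s₀ < s₁) : OrientedCell where
  param := Γ.quadParam j s₀ s₁ h₀ h₁
  continuous_param := Γ.quadParam_continuous j h₀ h₁
  injective_param := Γ.quadParam_injective j h₀ h₁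
  oriented := ⟨_, Γ.quadParam_isLift j h₀ h₁, Γ.quadLift_preservesOrientation j h₀ h₁⟩

/-- The points of the quadrilateral: with `φ = a j + t`, they are given by the inequalities
`0 ≤ t ≤ 2θ` and `δ j - 2θs₁ ≤ t ≤ δ j - 2θs₀`. -/
theorem quadCell_carrier (j : ZMod k) {s₀ s₁ : ℝ} (h₀ : 1 ≤ s₀) (h₁ : s₀ < s₁) :
    (Γ.quadCell j s₀ s₁ h₀ h₁).carrier = {x | ∃ t : ℝ, x.1 = Γ.a j + (t : Real.Angle) ∧
      0 ≤ t ∧ t ≤ 2 * x.2 ∧ Γ.δ j - 2 * x.2 * s₁ ≤ t ∧ t ≤ Γ.δ j - 2 * x.2 * s₀} := by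
  have hδ := Γ.δ_pos j
  ext ⟨φ, ⟨θ, hθ⟩⟩
  constructor
  · rintro ⟨p, hp⟩
    have hP := level_add_pos h₀ h₁ p
    have hl := level_ge h₁ p
    have hl' : level s₀ s₁ p ≤ s₁ := by unfold level; nlinarith [p.2.2.1]
    have hu := p.1.2.1
    have hu' := p.1.2.2
    have e1 := congrArg Prod.fst hp
    have e2 : Γ.δ j / (2 * (level s₀ s₁ p + p.1)) = θ :=
      congrArg (fun x : Phase => (x.2 : ℝ)) hp
    have e3 : Γ.δ j = 2 * θ * (level s₀ s₁ p + p.1) := by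
      rw [← e2]; field_simp
    have e4 : Γ.δ j * p.1 / (level s₀ s₁ p + p.1) = 2 * θ * p.1 := by
      rw [e3]; field_simp
    have h0 : 0 ≤ θ := hθ.1
    refine ⟨2 * θ * p.1, ?_, by positivity, ?_, ?_, ?_⟩
    · rw [← e4]; exact e1.symm
    · change 2 * θ * p.1 ≤ 2 * θ; nlinarith
    · change Γ.δ j - 2 * θ * s₁ ≤ 2 * θ * p.1; nlinarith
    · change 2 * θ * p.1 ≤ Γ.δ j - 2 * θ * s₀; nlinarith
  · rintro ⟨t, hφ, ht0, ht1, ht2, ht3⟩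
    change φ = _ at hφ
    change t ≤ 2 * θ at ht1
    change Γ.δ j - 2 * θ * s₁ ≤ t at ht2
    change t ≤ Γ.δ j - 2 * θ * s₀ at ht3
    have hθ0 : 0 < θ := by
      rcases hθ.1.eq_or_lt with h | h
      · subst h; linarith
      · exact h
    have hs : 0 < s₁ - s₀ := by linarith
    set s := (Γ.δ j - t) / (2 * θ) with hsdef
    have hst : 2 * θ * s = Γ.δ j - t := by rw [hsdef]; field_simp
    have hs0 : s₀ ≤ s := by rw [hsdef, le_div_iff₀ (by positivity)]; linarith
    have hs1 : s ≤ s₁ := by rw [hsdef, div_le_iff₀ (by positivity)]; linarith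
    let p : Square := (⟨t / (2 * θ), by positivity, by rw [div_le_one (by positivity)]; exact ht1⟩,
      ⟨(s₁ - s) / (s₁ - s₀), div_nonneg (by linarith) hs.le, by
        rw [div_le_one hs]; linarith⟩)
    have hlev : level s₀ s₁ p = s := by
      simp only [level, p]; field_simp; ring
    have hsum : level s₀ s₁ p + p.1 = Γ.δ j / (2 * θ) := by
      rw [hlev]; simp only [p]; rw [hsdef]; field_simp; ring
    refine ⟨p, Prod.ext ?_ (Subtype.ext ?_)⟩
    · change Γ.a j + ((Γ.δ j * (t / (2 * θ)) / (level s₀ s₁ p + p.1) : ℝ) : Real.Angle) = φ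
      rw [hsum, hφ]
      congr 2
      field_simp
    · change Γ.δ j / (2 * (level s₀ s₁ p + p.1)) = θ
      rw [hsum]; field_simp

theorem quadCell_left (j : ZMod k) {s₀ s₁ : ℝ} (h₀ : 1 ≤ s₀) (h₁ : s₀ < s₁) :
    (Γ.quadCell j s₀ s₁ h₀ h₁).left ⊆ Γ.singSegment j := by
  rintro _ ⟨p, hp, rfl⟩
  have hp : (p.1 : ℝ) = 0 := hp
  simp [singSegment, quadCell, quadParam, hp]

theorem quadCell_right (j : ZMod k) {s₀ s₁ : ℝ} (h₀ : 1 ≤ s₀) (h₁ : s₀ < s₁) :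
    (Γ.quadCell j s₀ s₁ h₀ h₁).right ⊆ Γ.forwardSegment j 1 := by
  rintro _ ⟨p, hp, rfl⟩
  have hp : (p.1 : ℝ) = 1 := hp
  have hP := level_add_pos h₀ h₁ p
  have hl := level_ge h₁ p
  have hδ := Γ.δ_pos j
  have e : 2 * (Γ.δ j / (2 * (level s₀ s₁ p + p.1))) * 1
      = Γ.δ j * p.1 / (level s₀ s₁ p + p.1) := by
    rw [hp]; rw [hp] at hP; field_simp
  refine ⟨?_, ?_⟩
  · change _ + _ = Γ.a j + ((2 * (Γ.δ j / (2 * (level s₀ s₁ p + p.1))) * 1 : ℝ) : Real.Angle)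
    rw [e]
  · change 2 * (Γ.δ j / (2 * (level s₀ s₁ p + p.1))) * 1 ≤ Γ.δ j
    rw [e, div_le_iff₀ hP, hp]
    nlinarith

lemma quadParam_mem_backwardSegment (j : ZMod k) {s₀ s₁ : ℝ} (h₀ : 1 ≤ s₀) (h₁ : s₀ < s₁)
    (p : Square) :
    Γ.quadParam j s₀ s₁ h₀ h₁ p ∈ Γ.backwardSegment (j + 1) (level s₀ s₁ p) := by
  have hP := level_add_pos h₀ h₁ p
  have hδ := Γ.δ_pos j
  have e : 2 * (Γ.δ j / (2 * (level s₀ s₁ p + p.1))) * level s₀ s₁ p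
      = Γ.δ j - Γ.δ j * p.1 / (level s₀ s₁ p + p.1) := by
    field_simp; ring
  refine ⟨?_, ?_⟩
  · change _ + _ = Γ.a (j + 1) -
      ((2 * (Γ.δ j / (2 * (level s₀ s₁ p + p.1))) * level s₀ s₁ p : ℝ) : Real.Angle)
    rw [e, Γ.a_succ, Real.Angle.coe_sub]; abel
  · change 2 * (Γ.δ j / (2 * (level s₀ s₁ p + p.1))) * level s₀ s₁ p ≤ _
    rw [e, add_sub_cancel_right]
    have := div_nonneg (mul_nonneg hδ.le p.1.2.1) hP.le
    linarith

theorem quadCell_base (j : ZMod k) {s₀ s₁ : ℝ} (h₀ : 1 ≤ s₀) (h₁ : s₀ < s₁) :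
    (Γ.quadCell j s₀ s₁ h₀ h₁).base ⊆ Γ.backwardSegment (j + 1) s₁ := by
  rintro _ ⟨p, hp, rfl⟩
  have hp : (p.2 : ℝ) = 0 := hp
  have h := Γ.quadParam_mem_backwardSegment j h₀ h₁ p
  have e : level s₀ s₁ p = s₁ := by simp [level, hp]
  rwa [e] at h

theorem quadCell_top (j : ZMod k) {s₀ s₁ : ℝ} (h₀ : 1 ≤ s₀) (h₁ : s₀ < s₁) :
    (Γ.quadCell j s₀ s₁ h₀ h₁).top ⊆ Γ.backwardSegment (j + 1) s₀ := by
  rintro _ ⟨p, hp, rfl⟩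
  have hp : (p.2 : ℝ) = 1 := hp
  have h := Γ.quadParam_mem_backwardSegment j h₀ h₁ p
  have e : level s₀ s₁ p = s₀ := by simp [level, hp]
  rwa [e] at h

end CircularPolygon

/-- The label `ς ∈ {-, +}` of the lower and upper halves of a fundamental quadrilateral. -/
inductive Half
  | minus
  | plus

namespace CircularPolygon

variable {k : ℕ} [NeZero k] (Γ : CircularPolygon k)

lemma one_le_sub_half {n : ℕ} (hn : 2 ≤ n) : (1 : ℝ) ≤ n - 1 / 2 := by
  have : (2 : ℝ) ≤ n := by exact_mod_cast hn
  linarith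

lemma one_le_sub_one {n : ℕ} (hn : 2 ≤ n) : (1 : ℝ) ≤ n - 1 := by
  have : (2 : ℝ) ≤ n := by exact_mod_cast hn
  linarith

/-- The `(ς, j, n)`-fundamental quadrilaterals. The `(j, n)`-fundamental quadrilateral lies between
the segments `s = n` and `s = n - 1`; the segment `s = n - 1/2` splits it into a lower half and
an upper half. -/
def fundQuad (j : ZMod k) (n : ℕ) (hn : 2 ≤ n) : Half → OrientedCell
  | .minus => Γ.quadCell j (n - 1 / 2) n (one_le_sub_half hn) (by linarith)
  | .plus => Γ.quadCell j (n - 1) (n - 1 / 2) (one_le_sub_one hn) (by linarith)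

/-! ### The constants and index sets -/

/-- `μ j = √(r j / r (j+1))`. -/
def μ (j : ZMod k) : ℝ := Real.sqrt (Γ.r j / Γ.r (j + 1))

/-- `α⁻ j = δ (j+1) / (δ j max{1, μ j})`. -/
def αMinus (j : ZMod k) : ℝ := Γ.δ (j + 1) / (Γ.δ j * max 1 (Γ.μ j))

/-- `α⁺ j = δ (j+1) / (δ j min{1, μ j})`. -/
def αPlus (j : ZMod k) : ℝ := Γ.δ (j + 1) / (Γ.δ j * min 1 (Γ.μ j))

def βMinus (j : ZMod k) : ℝ := Γ.αMinus j + 1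

def βPlus (j : ZMod k) : ℝ := Γ.αPlus j + 1

/-- The index set `Υ j`, for the integers `χ j`. -/
def Upsilon (χ : ZMod k → ℕ) (j : ZMod k) : Set (ℕ × ℕ) :=
  {q | Γ.αMinus j * q.1 + Γ.βMinus j ≤ q.2 ∧ (q.2 : ℝ) ≤ Γ.αPlus j * q.1 - Γ.βPlus j ∧
    χ j ≤ q.1 ∧ χ (j + 1) ≤ q.2}

/-- The index set `Ξ j`, for the integers `χ j`. -/
def Xi (χ : ZMod k → ℕ) (j : ZMod k) : Set (ℕ × ℕ) :=
  {q | Γ.αMinus j * q.1 + Γ.βMinus j < q.2 ∧ (q.2 : ℝ) < Γ.αPlus j * q.1 - Γ.βPlus j ∧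
    χ j ≤ q.1 ∧ χ (j + 1) ≤ q.2}

end CircularPolygon

end CircularBilliard

end

open CircularBilliard

/-!
Close to the boundary of the phase space the billiard in a circular polygon is explicit. On the
`j`-th arc it is the rotation `(φ, θ) ↦ (φ + 2θ, θ)`, and a chord that leaves the arc `j` at the
angle `θ` and lands on the arc `j + 1` at the angle `θ'` satisfies

  `sin²(θ'/2) = μ² sin²(θ/2) + (1 - μ²) sin²(x/2)`, with `μ² = r j / r (j+1)`,

where `x ∈ [-θ, θ]` is the angle between the normal at the node and the normal direction of the
chord (`billiardMap_of_crossing`). These formulas do give the billiard map, because a next impact is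
unique: along half of a turn of the tangent, the height of the curve over the chord is strictly
monotone (`height_strictAntiOn`, `IsNextImpact.unique`).

In the strip over the arc `j` one uses the coordinates `(s, u)` with
`φ = a j + 2θu = a (j+1) - 2θs`; the fundamental quadrilaterals are the rectangles
`n - 1 ≤ s ≤ n`, `0 ≤ u ≤ 1`, split at `s = n - 1/2`. There `x = θ(2(n - s) - 1)`, so that
`f^n` is a continuous function of `(s, u)` (`IsLarge.iterate_hasStripCoords`).
At the levels `s = n` and `s = n - 1` the chord has an end at the node and `θ' = θ`; at the
level `s = n - 1/2` one has `x = 0` and `sin(θ'/2) = μ sin(θ/2)`, and concavity of the sine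
compares `θ'` with `μθ`. Therefore the new level `s'` is at most
`α⁻ (n + 1) = α⁻ n + β⁻ - 1` on one horizontal side of each half and at least
`α⁺ (n - 1) - 1 = α⁺ n - β⁺` on the other one (`IsLarge.outS_ends`). If `(n, n') ∈ Υ j`, then the
interval `[n' - 1, n']` lies between these bounds, and the intermediate value theorem along vertical
paths gives the stretching (`IsLarge.stretches`).

If `(n, n') ∈ Ξ j`, the inequalities are strict, uniformly in `n'` because `n'` is an integer.
So the halves can be shrunk by a small amount at both horizontal sides and their images still cross
the whole halves of the next arc (`IsLarge.exists_shrink`); the shrunk halves are the slabs. On them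
`0 < |x| < θ`, which keeps the images off the extended singularity set
(`IsLarge.iterate_notMem_extendedSingularSet`).
-/

namespace CircularBilliard

/-! ### Angles and unit vectors -/

lemma expi_add (φ ψ : Real.Angle) : expi (φ + ψ) = expi φ * expi ψ := by
  simp [expi]

lemma expi_coe (x : ℝ) : expi (x : Real.Angle) = Real.cos x + Real.sin x * Complex.I := by
  rw [expi, Real.Angle.toCircle_coe, Circle.coe_exp, Complex.exp_mul_I]
  simp

lemma expi_injective : Function.Injective expi := fun φ ψ h => by
  rw [← Real.Angle.arg_toCircle φ, ← Real.Angle.arg_toCircle ψ, Subtype.ext h]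

lemma conj_expi_mul_expi (φ : Real.Angle) : (starRingEnd ℂ) (expi φ) * expi φ = 1 := by
  rw [mul_comm, Complex.mul_conj, Complex.normSq_eq_norm_sq, expi, Circle.norm_coe]
  simp

lemma expi_ne_zero (φ : Real.Angle) : expi φ ≠ 0 := by simp [expi]

namespace CircularPolygon

variable {k : ℕ} [NeZero k] (Γ : CircularPolygon k)

/-! ### Arcs of the polygon -/

lemma exists_inArc_right (φ : Real.Angle) :
    ∃ j, ∃ ε > 0, ∀ e : ℝ, 0 ≤ e → e ≤ ε → Γ.InArc (φ + (e : Real.Angle)) j := by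
  obtain ⟨j, t, ht0, ht1, ht⟩ := Γ.exists_inArc φ
  rcases ht1.eq_or_lt with h | h
  · refine ⟨j + 1, Γ.δ (j + 1), Γ.δ_pos _, fun e he he' => ⟨e, he, he', ?_⟩⟩
    rw [ht, h, Γ.a_succ]
  · refine ⟨j, Γ.δ j - t, by linarith, fun e he he' => ⟨t + e, by linarith, by linarith, ?_⟩⟩
    rw [ht, Real.Angle.coe_add, add_assoc]

lemma exists_inArc_left (φ : Real.Angle) :
    ∃ j, ∃ ε > 0, ∀ e : ℝ, 0 ≤ e → e ≤ ε → Γ.InArc (φ - (e : Real.Angle)) j := by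
  obtain ⟨j, t, ht0, ht1, ht⟩ := Γ.exists_inArc φ
  rcases ht0.eq_or_lt with h | h
  · refine ⟨j - 1, Γ.δ (j - 1), Γ.δ_pos _, fun e he he' =>
      ⟨Γ.δ (j - 1) - e, by linarith, by linarith, ?_⟩⟩
    have := Γ.a_succ (j - 1)
    rw [sub_add_cancel] at this
    rw [ht, ← h, Real.Angle.coe_zero, this, Real.Angle.coe_sub]
    abel
  · refine ⟨j, t, h, fun e he he' => ⟨t - e, by linarith, by linarith, ?_⟩⟩
    rw [ht, Real.Angle.coe_sub]
    abel

/-- The half-open arcs `[a j, a j + δ j)` are pairwise disjoint. -/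
lemma arc_coord_unique {i j : ZMod k} {t u : ℝ} (ht0 : 0 ≤ t) (ht : t < Γ.δ i) (hu0 : 0 ≤ u)
    (hu : u < Γ.δ j) (h : Γ.a i + (t : Real.Angle) = Γ.a j + (u : Real.Angle)) :
    i = j ∧ t = u := by
  have ei : ((i.val : ℕ) : ZMod k) = i := ZMod.natCast_zmod_val i
  have ej : ((j.val : ℕ) : ZMod k) = j := ZMod.natCast_zmod_val j
  have si := Γ.partialAngle_succ i.val
  have sj := Γ.partialAngle_succ j.val
  rw [ei] at si
  rw [ej] at sj
  have mono := Γ.partialAngle_mono.monotone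
  have mi : Γ.partialAngle (i.val + 1) ≤ Γ.partialAngle k := mono (ZMod.val_lt i)
  have mj : Γ.partialAngle (j.val + 1) ≤ Γ.partialAngle k := mono (ZMod.val_lt j)
  have mi0 : 0 ≤ Γ.partialAngle i.val := mono (Nat.zero_le _)
  have mj0 : 0 ≤ Γ.partialAngle j.val := mono (Nat.zero_le _)
  rw [Γ.partialAngle_card] at mi mj
  have ai := Γ.a_natCast i.val
  have aj := Γ.a_natCast j.val
  rw [ei] at ai
  rw [ej] at aj
  have key : ((Γ.partialAngle i.val + t : ℝ) : Real.Angle)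
      = ((Γ.partialAngle j.val + u : ℝ) : Real.Angle) := by
    rw [ai, aj, add_assoc, add_assoc, add_right_inj] at h
    rw [Real.Angle.coe_add, Real.Angle.coe_add]; exact h
  obtain ⟨n, hn⟩ := Real.Angle.angle_eq_iff_two_pi_dvd_sub.1 key
  have hpi := Real.pi_pos
  have l1 : (-1 : ℝ) < n := by
    by_contra hc
    push Not at hc
    nlinarith
  have l2 : (n : ℝ) < 1 := by
    by_contra hc
    push Not at hc
    nlinarith
  have l1' : -1 < n := by exact_mod_cast l1
  have l2' : n < 1 := by exact_mod_cast l2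
  have hn0 : n = 0 := by omega
  rw [hn0, Int.cast_zero, mul_zero] at hn
  have hij : i.val = j.val := by
    rcases lt_trichotomy i.val j.val with hlt | heq | hlt
    · have := mono (Nat.succ_le_of_lt hlt)
      rw [Nat.succ_eq_add_one] at this
      linarith
    · exact heq
    · have := mono (Nat.succ_le_of_lt hlt)
      rw [Nat.succ_eq_add_one] at this
      linarith
  refine ⟨ZMod.val_injective k hij, ?_⟩
  rw [hij] at hn
  linarith

/-! ### Uniqueness of the next impact -/

/-- The tangent turns by the sum of the two angles from one impact to the next. -/
lemma tangent_eq_iff (x y : Phase) :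
    tangent y.1 = expi ((y.2 : ℝ) : Real.Angle) * direction x ↔
      y.1 = x.1 + ((x.2 : ℝ) : Real.Angle) + ((y.2 : ℝ) : Real.Angle) := by
  have e : expi ((y.2 : ℝ) : Real.Angle) * direction x
      = Complex.I * expi (x.1 + ((x.2 : ℝ) : Real.Angle) + ((y.2 : ℝ) : Real.Angle)) := by
    simp only [direction, tangent, expi_add]; ring
  rw [e, tangent, mul_right_inj' Complex.I_ne_zero]
  exact expi_injective.eq_iff

/-- The coordinate of `z(ψ + τ)` along the outer normal direction `e^{iψ}`. -/
noncomputable def height (ψ : Real.Angle) (τ : ℝ) : ℝ :=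
  ((starRingEnd ℂ) (expi ψ) * Γ.z (ψ + (τ : Real.Angle))).re

lemma height_eq {ψ : Real.Angle} {τ : ℝ} {j : ZMod k} (h : Γ.InArc (ψ + (τ : Real.Angle)) j) :
    Γ.height ψ τ = ((starRingEnd ℂ) (expi ψ) * Γ.O j).re + Γ.r j * Real.cos τ := by
  have e : (starRingEnd ℂ) (expi ψ) * (Γ.O j + Γ.r j * (expi ψ * expi τ))
      = (starRingEnd ℂ) (expi ψ) * Γ.O j + Γ.r j * expi τ := by
    linear_combination (Γ.r j * expi τ) * conj_expi_mul_expi ψ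
  rw [height, Γ.z_eq h, expi_add, e, expi_coe]
  simp [-Complex.ofReal_cos]

lemma height_hasDerivWithinAt_Ici (ψ : Real.Angle) (τ : ℝ) :
    ∃ j, HasDerivWithinAt (Γ.height ψ) (-(Γ.r j * Real.sin τ)) (Ici τ) τ := by
  obtain ⟨j, ε, hε, H⟩ := Γ.exists_inArc_right (ψ + (τ : Real.Angle))
  refine ⟨j, ?_⟩
  have h1 : HasDerivAt (fun τ' => ((starRingEnd ℂ) (expi ψ) * Γ.O j).re + Γ.r j * Real.cos τ')
      (-(Γ.r j * Real.sin τ)) τ := by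
    simpa using ((Real.hasDerivAt_cos τ).const_mul (Γ.r j)).const_add
      ((starRingEnd ℂ) (expi ψ) * Γ.O j).re
  have key : ∀ τ' ∈ Icc τ (τ + ε), Γ.height ψ τ'
      = ((starRingEnd ℂ) (expi ψ) * Γ.O j).re + Γ.r j * Real.cos τ' := by
    intro τ' h
    apply Γ.height_eq
    have := H (τ' - τ) (by linarith [h.1]) (by linarith [h.2])
    rwa [add_assoc, ← Real.Angle.coe_add, add_sub_cancel] at this
  refine h1.hasDerivWithinAt.congr_of_eventuallyEq ?_ (key τ ⟨le_rfl, by linarith⟩)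
  filter_upwards [Icc_mem_nhdsGE (show τ < τ + ε by linarith)] with τ' h using key τ' h

lemma continuous_height (ψ : Real.Angle) : Continuous (Γ.height ψ) := by
  rw [continuous_iff_continuousAt]
  intro τ
  rw [continuousAt_iff_continuous_left_right]
  refine ⟨?_, (Γ.height_hasDerivWithinAt_Ici ψ τ).choose_spec.continuousWithinAt⟩
  obtain ⟨j, ε, hε, H⟩ := Γ.exists_inArc_left (ψ + (τ : Real.Angle))
  have key : ∀ τ' ∈ Icc (τ - ε) τ, Γ.height ψ τ'
      = ((starRingEnd ℂ) (expi ψ) * Γ.O j).re + Γ.r j * Real.cos τ' := by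
    intro τ' h
    apply Γ.height_eq
    have := H (τ - τ') (by linarith [h.2]) (by linarith [h.1])
    rwa [add_sub_assoc, ← Real.Angle.coe_sub, sub_sub_cancel] at this
  have h1 : Continuous fun τ' => ((starRingEnd ℂ) (expi ψ) * Γ.O j).re + Γ.r j * Real.cos τ' := by
    fun_prop
  refine h1.continuousWithinAt.congr_of_eventuallyEq ?_ (key τ ⟨by linarith, le_rfl⟩)
  filter_upwards [Icc_mem_nhdsLE (show τ - ε < τ by linarith)] with τ' h using key τ' h

/-- Strict convexity: on the half of the curve whose tangent makes an angle in `(0, π)` with the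
direction `ie^{iψ}`, the coordinate along `e^{iψ}` decreases at least as fast as on a circle of the
smallest radius. -/
lemma height_strictAntiOn (ψ : Real.Angle) : StrictAntiOn (Γ.height ψ) (Icc 0 Real.pi) := by
  obtain ⟨i, hi⟩ := Finite.exists_min Γ.r
  intro τ₁ h₁ τ₂ h₂ h
  choose g hg using Γ.height_hasDerivWithinAt_Ici ψ
  have key := image_le_of_deriv_right_le_deriv_boundary (f := Γ.height ψ)
    (f' := fun τ => -(Γ.r (g τ) * Real.sin τ)) (a := τ₁) (b := τ₂)
    (Γ.continuous_height ψ).continuousOn (fun x _ => hg x)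
    (B := fun τ => Γ.height ψ τ₁ - Γ.r i * Real.cos τ₁ + Γ.r i * Real.cos τ)
    (B' := fun τ => -(Γ.r i * Real.sin τ)) (by simp) (by fun_prop)
    (fun x _ => by
      have : HasDerivAt (fun τ => Γ.height ψ τ₁ - Γ.r i * Real.cos τ₁ + Γ.r i * Real.cos τ)
          (-(Γ.r i * Real.sin x)) x := by
        simpa using ((Real.hasDerivAt_cos x).const_mul (Γ.r i)).const_add
          (Γ.height ψ τ₁ - Γ.r i * Real.cos τ₁)
      exact this.hasDerivWithinAt)
    (fun x hx => by
      have : 0 ≤ Real.sin x :=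
        Real.sin_nonneg_of_nonneg_of_le_pi (h₁.1.trans hx.1) (hx.2.le.trans h₂.2)
      nlinarith [hi (g x)]) (right_mem_Icc.2 h.le)
  have := Real.strictAntiOn_cos h₁ h₂ h
  have := mul_lt_mul_of_pos_left this (Γ.r_pos i)
  linarith

lemma IsNextImpact.unique {Γ : CircularPolygon k} {x y y' : Phase} (h : Γ.IsNextImpact x y)
    (h' : Γ.IsNextImpact x y') : y = y' := by
  have key : ∀ {w : Phase}, Γ.IsNextImpact x w →
      w.1 = x.1 + ((x.2 : ℝ) : Real.Angle) + ((w.2 : ℝ) : Real.Angle) ∧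
      Γ.height (x.1 + ((x.2 : ℝ) : Real.Angle)) w.2
        = ((starRingEnd ℂ) (expi (x.1 + ((x.2 : ℝ) : Real.Angle))) * Γ.z x.1).re := by
    rintro w ⟨-, ⟨c, hc⟩, -, ht⟩
    have e := (tangent_eq_iff x w).1 ht
    refine ⟨e, ?_⟩
    have e2 : (starRingEnd ℂ) (expi (x.1 + ((x.2 : ℝ) : Real.Angle))) * (c * direction x)
        = c * Complex.I := by
      have e3 : direction x = Complex.I * expi (x.1 + ((x.2 : ℝ) : Real.Angle)) := by
        rw [direction, tangent, expi_add]; ring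
      rw [e3]
      linear_combination (c * Complex.I) *
        conj_expi_mul_expi (x.1 + ((x.2 : ℝ) : Real.Angle))
    rw [height, ← e, hc, mul_add, e2]
    simp
  obtain ⟨e, k1⟩ := key h
  obtain ⟨e', k2⟩ := key h'
  have e2 : (y.2 : ℝ) = y'.2 :=
    (Γ.height_strictAntiOn _).injOn y.2.2 y'.2.2 (k1.trans k2.symm)
  exact Prod.ext (by rw [e, e', e2]) (Subtype.ext e2)

lemma billiardMap_eq {x y : Phase} (h0 : 0 < (x.2 : ℝ)) (h1 : (x.2 : ℝ) < Real.pi)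
    (h : Γ.IsNextImpact x y) : Γ.billiardMap x = y := by
  have hx : (0 < (x.2 : ℝ) ∧ (x.2 : ℝ) < Real.pi) ∧ ∃ y, Γ.IsNextImpact x y := ⟨⟨h0, h1⟩, y, h⟩
  rw [billiardMap, dif_pos hx]
  exact hx.2.choose_spec.unique h

/-! ### Impacts on the same arc -/

/-- Consecutive impacts on the same arc: the billiard in a circle. -/
lemma billiardMap_of_same_arc {j : ZMod k} {t : ℝ} {x y : Phase}
    (hx : x.1 = Γ.a j + (t : Real.Angle)) (hx0 : 0 < (x.2 : ℝ)) (hx1 : (x.2 : ℝ) < Real.pi)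
    (ht : 0 ≤ t) (ht' : t + 2 * x.2 ≤ Γ.δ j)
    (hy : y.1 = Γ.a j + ((t + 2 * x.2 : ℝ) : Real.Angle)) (hy2 : y.2 = x.2) :
    Γ.billiardMap x = y := by
  apply Γ.billiardMap_eq hx0 hx1
  have e : y.1 = x.1 + ((x.2 : ℝ) : Real.Angle) + ((y.2 : ℝ) : Real.Angle) := by
    rw [hy, hx, hy2, two_mul, Real.Angle.coe_add, Real.Angle.coe_add]; abel
  have hs := Real.sin_pos_of_pos_of_lt_pi hx0 hx1
  have zx : Γ.z x.1 = Γ.O j + Γ.r j * expi x.1 := Γ.z_eq ⟨t, ht, by linarith, hx⟩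
  have zy : Γ.z y.1 = Γ.O j + Γ.r j * expi y.1 := Γ.z_eq ⟨_, by linarith, ht', hy⟩
  have hz : Γ.z y.1 = Γ.z x.1 + (2 * Γ.r j * Real.sin x.2 : ℝ) * direction x := by
    rw [zx, zy, e, hy2, direction, tangent, expi_add, expi_add, expi_coe]
    have h2 : ((Real.cos x.2 : ℝ) : ℂ) ^ 2 + ((Real.sin x.2 : ℝ) : ℂ) ^ 2 = 1 := by
      exact_mod_cast Real.cos_sq_add_sin_sq x.2
    push_cast at h2 ⊢
    linear_combination (Γ.r j * expi x.1) * h2 -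
      Γ.r j * expi x.1 * (Complex.sin x.2) ^ 2 * Complex.I_sq
  refine ⟨?_, ⟨_, hz⟩, by rw [hy2]; exact ⟨hx0, hx1⟩, (tangent_eq_iff x y).2 e⟩
  rw [hz, Ne, add_eq_left, mul_eq_zero, not_or]
  refine ⟨?_, ?_⟩
  · have := Γ.r_pos j
    exact_mod_cast (by positivity : (2 * Γ.r j * Real.sin x.2 : ℝ) ≠ 0)
  · exact mul_ne_zero (expi_ne_zero _) (mul_ne_zero Complex.I_ne_zero (expi_ne_zero _))

lemma billiardMap_iterate_of_same_arc {j : ZMod k} {t : ℝ} {x : Phase}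
    (hx : x.1 = Γ.a j + (t : Real.Angle)) (hx0 : 0 < (x.2 : ℝ)) (hx1 : (x.2 : ℝ) < Real.pi)
    (ht : 0 ≤ t) (m : ℕ) (ht' : t + 2 * m * x.2 ≤ Γ.δ j) :
    Γ.billiardMap^[m] x = (Γ.a j + ((t + 2 * m * x.2 : ℝ) : Real.Angle), x.2) := by
  induction m with
  | zero => simp [← hx]
  | succ m ih =>
    push_cast at ht'
    rw [Function.iterate_succ_apply', ih (by linarith)]
    refine Γ.billiardMap_of_same_arc (t := t + 2 * m * x.2) rfl hx0 hx1 (by positivity) ?_ ?_ rfl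
    · simp only; linarith
    · simp only; push_cast; congr 2; ring

end CircularPolygon

/-! ### The law of reflection across a node -/

lemma sin_sq_half_abs (x : ℝ) : Real.sin (|x| / 2) ^ 2 = Real.sin (x / 2) ^ 2 := by
  rcases abs_choice x with h | h <;> rw [h]
  rw [neg_div, Real.sin_neg, neg_sq]

lemma sin_sq_half_le {x θ : ℝ} (h : |x| ≤ θ) (hθ : θ ≤ Real.pi) :
    Real.sin (x / 2) ^ 2 ≤ Real.sin (θ / 2) ^ 2 := by
  have hx := abs_nonneg x
  rw [← sin_sq_half_abs x]
  have h0 : 0 ≤ Real.sin (|x| / 2) :=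
    Real.sin_nonneg_of_nonneg_of_le_pi (by linarith) (by linarith)
  have h1 : Real.sin (|x| / 2) ≤ Real.sin (θ / 2) :=
    Real.sin_le_sin_of_le_of_le_pi_div_two (by linarith) (by linarith) (by linarith)
  gcongr

lemma sin_sq_half_lt {x θ : ℝ} (h : |x| < θ) (hθ : θ ≤ Real.pi) :
    Real.sin (x / 2) ^ 2 < Real.sin (θ / 2) ^ 2 := by
  have hx := abs_nonneg x
  rw [← sin_sq_half_abs x]
  have h0 : 0 ≤ Real.sin (|x| / 2) :=
    Real.sin_nonneg_of_nonneg_of_le_pi (by linarith) (by linarith)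
  have h1 : Real.sin (|x| / 2) < Real.sin (θ / 2) :=
    Real.sin_lt_sin_of_lt_of_le_pi_div_two (by linarith) (by linarith) (by linarith)
  gcongr

/-- The value of `sin²(θ' / 2)` for the angle of incidence `θ'` after a chord that crosses a node,
where `m² = r j / r (j+1)`, `θ` is the angle at which the chord leaves the `j`-th arc, and `x` is
the angle from the normal at the node to the normal direction of the chord. -/
noncomputable def crossSq (m θ x : ℝ) : ℝ :=
  m ^ 2 * Real.sin (θ / 2) ^ 2 + (1 - m ^ 2) * Real.sin (x / 2) ^ 2

/-- The angle of incidence after a chord that crosses a node; see `crossSq`. -/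
noncomputable def crossAngle (m θ x : ℝ) : ℝ := 2 * Real.arcsin (√(crossSq m θ x))

lemma continuous_crossAngle (m : ℝ) : Continuous fun p : ℝ × ℝ => crossAngle m p.1 p.2 := by
  unfold crossAngle crossSq
  have := Real.continuous_arcsin
  fun_prop

section crossing

variable {m θ x κ : ℝ} (hm : 0 < m) (hx : |x| ≤ θ) (hθ : 0 < θ) (hκ0 : 0 < κ)
  (hκ : κ ≤ Real.pi / 2) (hs : max 1 m * θ ≤ 2 * Real.sin (κ / 2))

include hθ hκ0 hs in
lemma le_of_small : θ ≤ κ := by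
  have h1 : Real.sin (κ / 2) ≤ κ / 2 := Real.sin_le (by linarith)
  have h2 : 1 * θ ≤ max 1 m * θ := by gcongr; exact le_max_left _ _
  linarith

include hθ hκ0 hs in
lemma mul_le_of_small : m * θ ≤ κ := by
  have h1 : Real.sin (κ / 2) ≤ κ / 2 := Real.sin_le (by linarith)
  have h2 : m * θ ≤ max 1 m * θ := by gcongr; exact le_max_right _ _
  linarith

include hm hx hθ hκ0 hκ hs

lemma crossSq_pos : 0 < crossSq m θ x := by
  have hθκ := le_of_small hθ hκ0 hs
  have h1 := sin_sq_half_le hx (by linarith [Real.pi_pos])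
  have h2 : 0 < Real.sin (θ / 2) := Real.sin_pos_of_pos_of_lt_pi (by linarith) (by linarith)
  have h3 := sq_nonneg (Real.sin (x / 2))
  have e : crossSq m θ x = Real.sin (x / 2) ^ 2
      + m ^ 2 * (Real.sin (θ / 2) ^ 2 - Real.sin (x / 2) ^ 2) := by unfold crossSq; ring
  rcases h3.eq_or_lt with h | h
  · rw [e, ← h]; simp only [sub_zero, zero_add]; positivity
  · rw [e]
    have := mul_nonneg (sq_nonneg m) (sub_nonneg.2 h1)
    linarith

/-- The hypothesis `max 1 m * θ ≤ 2 sin(κ/2)` is made for this bound: it keeps the angle of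
incidence below `κ`, and the value of the square root in the domain of the arcsine. -/
lemma sqrt_crossSq_le : √(crossSq m θ x) ≤ Real.sin (κ / 2) := by
  have hθκ := le_of_small hθ hκ0 hs
  have h1 := sin_sq_half_le hx (by linarith [Real.pi_pos])
  have h2 : 0 < Real.sin (θ / 2) := Real.sin_pos_of_pos_of_lt_pi (by linarith) (by linarith)
  have h3 : Real.sin (θ / 2) ≤ θ / 2 := Real.sin_le (by linarith)
  have h4 : max 1 m * Real.sin (θ / 2) ≤ Real.sin (κ / 2) := by
    have : max 1 m * Real.sin (θ / 2) ≤ max 1 m * (θ / 2) := by gcongr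
    linarith
  rw [Real.sqrt_le_iff]
  have h5 : 0 ≤ max 1 m * Real.sin (θ / 2) := by positivity
  refine ⟨h5.trans h4, ?_⟩
  calc crossSq m θ x ≤ (max 1 m * Real.sin (θ / 2)) ^ 2 := ?_
    _ ≤ _ := by gcongr
  unfold crossSq
  have h6 := sq_nonneg (Real.sin (x / 2))
  have h7 := sq_nonneg (Real.sin (θ / 2))
  rcases le_total m 1 with h | h
  · rw [max_eq_left h]
    have : 0 ≤ (1 - m ^ 2) * (Real.sin (θ / 2) ^ 2 - Real.sin (x / 2) ^ 2) :=
      mul_nonneg (by nlinarith) (sub_nonneg.2 h1)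
    linarith
  · rw [max_eq_right h]
    have : 0 ≤ (m ^ 2 - 1) * Real.sin (x / 2) ^ 2 := mul_nonneg (by nlinarith) h6
    linarith

lemma sin_crossAngle : Real.sin (crossAngle m θ x / 2) = √(crossSq m θ x) := by
  rw [crossAngle, mul_div_cancel_left₀ _ two_ne_zero]
  exact Real.sin_arcsin (by linarith [Real.sqrt_nonneg (crossSq m θ x)])
    ((sqrt_crossSq_le hm hx hθ hκ0 hκ hs).trans (Real.sin_le_one _))

lemma sin_crossAngle_sq : Real.sin (crossAngle m θ x / 2) ^ 2 = crossSq m θ x := by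
  rw [sin_crossAngle hm hx hθ hκ0 hκ hs, Real.sq_sqrt (crossSq_pos hm hx hθ hκ0 hκ hs).le]

lemma crossAngle_pos : 0 < crossAngle m θ x := by
  have := Real.arcsin_pos.2 (Real.sqrt_pos.2 (crossSq_pos hm hx hθ hκ0 hκ hs))
  unfold crossAngle; linarith

lemma crossAngle_le : crossAngle m θ x ≤ κ := by
  have := Real.monotone_arcsin (sqrt_crossSq_le hm hx hθ hκ0 hκ hs)
  rw [Real.arcsin_sin (by linarith) (by linarith)] at this
  unfold crossAngle; linarith

/-- The chord meets the next arc after the node. -/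
lemma abs_le_crossAngle : |x| ≤ crossAngle m θ x := by
  have hθκ := le_of_small hθ hκ0 hs
  have hle := crossAngle_le hm hx hθ hκ0 hκ hs
  by_contra! h
  have h1 := sin_sq_half_lt (x := crossAngle m θ x) (θ := |x|)
    (by rwa [abs_of_pos (crossAngle_pos hm hx hθ hκ0 hκ hs)]) (by linarith [Real.pi_pos])
  rw [sin_crossAngle_sq hm hx hθ hκ0 hκ hs] at h1
  rw [sin_sq_half_abs] at h1
  have h2 := sin_sq_half_le hx (by linarith [Real.pi_pos])
  have := mul_nonneg (sq_nonneg m) (sub_nonneg.2 h2)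
  unfold crossSq at h1
  nlinarith

lemma abs_lt_crossAngle (hx' : |x| < θ) : |x| < crossAngle m θ x := by
  refine (abs_le_crossAngle hm hx hθ hκ0 hκ hs).lt_of_ne fun h => ?_
  have hθκ := le_of_small hθ hκ0 hs
  have h1 := sin_crossAngle_sq hm hx hθ hκ0 hκ hs
  rw [← h] at h1
  rw [sin_sq_half_abs] at h1
  have h2 := sin_sq_half_lt hx' (by linarith [Real.pi_pos])
  have := mul_pos (pow_pos hm 2) (sub_pos.2 h2)
  unfold crossSq at h1
  nlinarith

omit hm hx in
/-- A chord with an end at the node, where `x = ±θ`, has equal angles at its two ends. -/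
lemma crossAngle_of_abs_eq (h : |x| = θ) : crossAngle m θ x = θ := by
  have hθκ := le_of_small hθ hκ0 hs
  have e : Real.sin (x / 2) ^ 2 = Real.sin (θ / 2) ^ 2 := by rw [← h, sin_sq_half_abs]
  have e2 : crossSq m θ x = Real.sin (θ / 2) ^ 2 := by rw [crossSq, e]; ring
  rw [crossAngle, e2, Real.sqrt_sq (Real.sin_nonneg_of_nonneg_of_le_pi (by linarith) (by linarith)),
    Real.arcsin_sin (by linarith) (by linarith)]
  ring

omit hx hκ0 in
lemma sin_crossAngle_zero (hκ0 : 0 < κ) :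
    Real.sin (crossAngle m θ 0 / 2) = m * Real.sin (θ / 2) := by
  have hθκ := le_of_small hθ hκ0 hs
  have hx : |(0 : ℝ)| ≤ θ := by simpa using hθ.le
  have h2 : 0 < Real.sin (θ / 2) := Real.sin_pos_of_pos_of_lt_pi (by linarith) (by linarith)
  rw [sin_crossAngle hm hx hθ hκ0 hκ hs]
  have : crossSq m θ 0 = (m * Real.sin (θ / 2)) ^ 2 := by simp [crossSq]; ring
  rw [this, Real.sqrt_sq (by positivity)]

omit hx in
lemma crossAngle_zero_le (h1 : m ≤ 1) : crossAngle m θ 0 ≤ m * θ := by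
  have hθκ := le_of_small hθ hκ0 hs
  have hx : |(0 : ℝ)| ≤ θ := by simpa using hθ.le
  by_contra! h
  have hle := crossAngle_le hm hx hθ hκ0 hκ hs
  have e := sin_crossAngle_zero hm hθ hκ hs hκ0
  have h3 : Real.sin (m * θ / 2) < Real.sin (crossAngle m θ 0 / 2) :=
    Real.sin_lt_sin_of_lt_of_le_pi_div_two (by nlinarith) (by linarith) (by linarith)
  -- concavity of the sine on `[0, θ / 2]`
  have h4 := strictConcaveOn_sin_Icc.concaveOn.2 (left_mem_Icc.2 Real.pi_pos.le)
    (show θ / 2 ∈ Icc 0 Real.pi from ⟨by linarith, by linarith⟩) (sub_nonneg.2 h1) hm.le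
    (by ring)
  simp only [smul_eq_mul, mul_zero, Real.sin_zero, zero_add] at h4
  rw [mul_div_assoc] at h3
  linarith

omit hx in
lemma le_crossAngle_zero (h1 : 1 ≤ m) : m * θ ≤ crossAngle m θ 0 := by
  have hmκ := mul_le_of_small hθ hκ0 hs
  have hx : |(0 : ℝ)| ≤ θ := by simpa using hθ.le
  by_contra! h
  have h0 := crossAngle_pos hm hx hθ hκ0 hκ hs
  have e := sin_crossAngle_zero hm hθ hκ hs hκ0
  have h3 : Real.sin (crossAngle m θ 0 / 2) < Real.sin (m * θ / 2) :=
    Real.sin_lt_sin_of_lt_of_le_pi_div_two (by linarith) (by linarith) (by linarith)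
  -- concavity of the sine on `[0, mθ / 2]`
  have h5 : m⁻¹ ≤ 1 := inv_le_one_of_one_le₀ h1
  have h4 := strictConcaveOn_sin_Icc.concaveOn.2 (left_mem_Icc.2 Real.pi_pos.le)
    (show m * θ / 2 ∈ Icc 0 Real.pi from ⟨by positivity, by linarith⟩) (sub_nonneg.2 h5)
    (inv_pos.2 hm).le (by ring)
  simp only [smul_eq_mul, mul_zero, Real.sin_zero, zero_add] at h4
  have e2 : m⁻¹ * (m * θ / 2) = θ / 2 := by field_simp
  rw [e2, inv_mul_le_iff₀ hm] at h4
  linarith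

end crossing

namespace CircularPolygon

variable {k : ℕ} [NeZero k] (Γ : CircularPolygon k)

lemma μ_pos (j : ZMod k) : 0 < Γ.μ j :=
  Real.sqrt_pos.2 (div_pos (Γ.r_pos j) (Γ.r_pos (j + 1)))

lemma r_eq (j : ZMod k) : Γ.r j = Γ.μ j ^ 2 * Γ.r (j + 1) := by
  have h := Γ.r_pos (j + 1)
  rw [μ, Real.sq_sqrt (div_pos (Γ.r_pos j) h).le]
  field_simp

/-- A bound for the angles of incidence on the arc `j + 1` which ensures that a chord crossing
the node lands on that arc. -/
noncomputable def angleBound (j : ZMod k) : ℝ := min (Γ.δ (j + 1) / 2) (Real.pi / 2)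

lemma angleBound_pos (j : ZMod k) : 0 < Γ.angleBound j :=
  lt_min (half_pos (Γ.δ_pos _)) (half_pos Real.pi_pos)

/-- The impact after a chord from the arc `j` to the arc `j + 1`. -/
lemma billiardMap_of_crossing {j : ZMod k} {θ x θ' : ℝ} {p q : Phase} (hθ : 0 < θ) (hx : |x| ≤ θ)
    (hs : max 1 (Γ.μ j) * θ ≤ 2 * Real.sin (Γ.angleBound j / 2))
    (hp0 : 0 ≤ Γ.δ j + x - θ)
    (hp1 : p.1 = Γ.a j + ((Γ.δ j + x - θ : ℝ) : Real.Angle)) (hp2 : (p.2 : ℝ) = θ)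
    (hθ' : θ' = crossAngle (Γ.μ j) θ x)
    (hq1 : q.1 = Γ.a (j + 1) + ((x + θ' : ℝ) : Real.Angle)) (hq2 : (q.2 : ℝ) = θ') :
    Γ.billiardMap p = q := by
  have hm := Γ.μ_pos j
  have hκ0 := Γ.angleBound_pos j
  have hκ : Γ.angleBound j ≤ Real.pi / 2 := min_le_right _ _
  have hκ2 : Γ.angleBound j ≤ Γ.δ (j + 1) / 2 := min_le_left _ _
  have hθκ := le_of_small hθ hκ0 hs
  have hpos := crossAngle_pos hm hx hθ hκ0 hκ hs
  have hle := crossAngle_le hm hx hθ hκ0 hκ hs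
  have habs := abs_le_crossAngle hm hx hθ hκ0 hκ hs
  have hsq := sin_crossAngle_sq hm hx hθ hκ0 hκ hs
  rw [← hθ'] at hpos hle habs hsq
  have hpi := Real.pi_pos
  have x1 := (abs_le.1 hx).1
  have x2 := (abs_le.1 hx).2
  have x3 := (abs_le.1 habs).1
  have x4 := (abs_le.1 habs).2
  have hr := Γ.r_eq j
  have hr1 := Γ.r_pos (j + 1)
  have hr0 := Γ.r_pos j
  apply Γ.billiardMap_eq (by linarith) (by linarith)
  have hp1' : p.1 = Γ.a (j + 1) + (x : Real.Angle) - (θ : Real.Angle) := by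
    rw [hp1, Γ.a_succ, Real.Angle.coe_sub, Real.Angle.coe_add]; abel
  have e : q.1 = p.1 + ((p.2 : ℝ) : Real.Angle) + ((q.2 : ℝ) : Real.Angle) := by
    rw [hq1, hp1', hp2, hq2, Real.Angle.coe_add]; abel
  have zp : Γ.z p.1 = Γ.O j + Γ.r j * expi p.1 := Γ.z_eq ⟨_, hp0, by linarith, hp1⟩
  have zq : Γ.z q.1 = Γ.O (j + 1) + Γ.r (j + 1) * expi q.1 :=
    Γ.z_eq ⟨_, by linarith, by linarith, hq1⟩
  have hdir : direction p = Complex.I * expi (Γ.a (j + 1)) * expi x := by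
    rw [direction, tangent, hp1', hp2, mul_left_comm, ← expi_add, mul_assoc, ← expi_add]
    congr 2; abel
  -- the chord is orthogonal to the normal direction
  have hre : Γ.r j * (Real.cos x - Real.cos θ)
      + Γ.r (j + 1) * (Real.cos θ' - Real.cos x) = 0 := by
    have c : ∀ y : ℝ, Real.cos y = 1 - 2 * Real.sin (y / 2) ^ 2 := by
      intro y
      rw [Real.sin_sq_eq_half_sub, mul_div_cancel₀ y two_ne_zero]; ring
    rw [c x, c θ, c θ', hsq, crossSq, hr]
    ring
  set c : ℝ := Γ.r j * (Real.sin θ - Real.sin x) + Γ.r (j + 1) * (Real.sin θ' + Real.sin x) with hc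
  have hcpos : 0 < c := by
    have s1 : 0 ≤ Real.sin θ' + Real.sin x := by
      have : Real.sin (-θ') ≤ Real.sin x :=
        Real.sin_le_sin_of_le_of_le_pi_div_two (by linarith) (by linarith) (by linarith)
      rw [Real.sin_neg] at this; linarith
    rcases x2.eq_or_lt with h | h
    · have : 0 < Real.sin x := Real.sin_pos_of_pos_of_lt_pi (by linarith) (by linarith)
      have : 0 < Real.sin θ' := Real.sin_pos_of_pos_of_lt_pi (by linarith) (by linarith)
      rw [hc, ← h, sub_self, mul_zero, zero_add]; positivity
    · have s2 : 0 < Real.sin θ - Real.sin x := by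
        have : Real.sin x < Real.sin θ :=
          Real.sin_lt_sin_of_lt_of_le_pi_div_two (by linarith) (by linarith) (by linarith)
        linarith
      positivity
  have hz : Γ.z q.1 = Γ.z p.1 + c * direction p := by
    have hnode := Γ.node_eq j
    have ep : expi p.1 = expi (Γ.a (j + 1)) * expi (x : Real.Angle) *
        (Real.cos θ - Real.sin θ * Complex.I) := by
      rw [hp1', sub_eq_add_neg, expi_add, expi_add, ← Real.Angle.coe_neg, expi_coe (-θ)]
      simp [sub_eq_add_neg]
    have eq' : expi q.1 = expi (Γ.a (j + 1)) * expi (x : Real.Angle) *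
        (Real.cos θ' + Real.sin θ' * Complex.I) := by
      rw [hq1, Real.Angle.coe_add, expi_add, expi_add, expi_coe θ', mul_assoc]
    have hx1 : expi (x : Real.Angle) * (Real.cos x - Real.sin x * Complex.I) = 1 := by
      rw [expi_coe]
      have h2 : ((Real.cos x : ℝ) : ℂ) ^ 2 + ((Real.sin x : ℝ) : ℂ) ^ 2 = 1 := by
        exact_mod_cast Real.cos_sq_add_sin_sq x
      linear_combination h2 - ((Real.sin x : ℝ) : ℂ) ^ 2 * Complex.I_sq
    have hre' : (Γ.r j : ℂ) * (Real.cos x - Real.cos θ)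
      + Γ.r (j + 1) * (Real.cos θ' - Real.cos x) = 0 := by exact_mod_cast hre
    rw [zp, zq, hdir, ep, eq', hc]
    simp only [Complex.ofReal_add, Complex.ofReal_mul, Complex.ofReal_sub]
    linear_combination -hnode + expi (Γ.a (j + 1)) * expi (x : Real.Angle) * hre' +
      (Γ.r (j + 1) - Γ.r j) * expi (Γ.a (j + 1)) * hx1
  refine ⟨?_, ⟨_, hz⟩, ⟨by linarith, by linarith⟩, (tangent_eq_iff p q).2 e⟩
  rw [hz, Ne, add_eq_left, mul_eq_zero, not_or]
  refine ⟨by exact_mod_cast hcpos.ne', ?_⟩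
  rw [hdir]
  exact mul_ne_zero (mul_ne_zero Complex.I_ne_zero (expi_ne_zero _)) (expi_ne_zero _)

/-! ### The passage from a fundamental quadrilateral to the next arc -/

/-- The angle `θ` of the point of the `j`-th strip with coordinates `(s, u)`, that is, the point
with `φ = a j + 2θu = a (j+1) - 2θs`. -/
noncomputable def stripAngle (j : ZMod k) (s u : ℝ) : ℝ := Γ.δ j / (2 * (s + u))

/-- The point `p` has coordinates `(s, u)` in the `j`-th strip: `φ = a j + 2θu` and
`δ j = 2θ(s + u)`. -/
def HasStripCoords (j : ZMod k) (s u : ℝ) (p : Phase) : Prop :=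
  p.1 = Γ.a j + ((2 * Γ.stripAngle j s u * u : ℝ) : Real.Angle) ∧
    (p.2 : ℝ) = Γ.stripAngle j s u

/-- The angle from the normal at the node `a (j+1)` to the normal direction of the chord that
leaves the arc `j`, for the trajectory that starts at the coordinates `(s, u)` and crosses the node
at its `n`-th impact. -/
noncomputable def nodeOffset (j : ZMod k) (n : ℕ) (s u : ℝ) : ℝ :=
  Γ.stripAngle j s u * (2 * (n - s) - 1)

/-- The angle `θ` after the `n`-th impact, for the trajectory that starts at the coordinates
`(s, u)`. -/
noncomputable def outAngle (j : ZMod k) (n : ℕ) (s u : ℝ) : ℝ :=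
  crossAngle (Γ.μ j) (Γ.stripAngle j s u) (Γ.nodeOffset j n s u)

/-- The `u`-coordinate in the next strip after the `n`-th impact. -/
noncomputable def outU (j : ZMod k) (n : ℕ) (s u : ℝ) : ℝ :=
  (Γ.nodeOffset j n s u + Γ.outAngle j n s u) / (2 * Γ.outAngle j n s u)

/-- The `s`-coordinate in the next strip after the `n`-th impact. -/
noncomputable def outS (j : ZMod k) (n : ℕ) (s u : ℝ) : ℝ :=
  Γ.δ (j + 1) / (2 * Γ.outAngle j n s u) - Γ.outU j n s u

/-- The index `n` is so large that the trajectories from the `(j, n)`-fundamental quadrilaterals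
are close enough to the boundary to land on the arc `j + 1` at the `n`-th impact. -/
def IsLarge (j : ZMod k) (n : ℕ) : Prop :=
  2 ≤ n ∧ max 1 (Γ.μ j) * Γ.δ j ≤ 4 * (n - 1) * Real.sin (Γ.angleBound j / 2)

lemma exists_isLarge (j : ZMod k) : ∃ N : ℕ, ∀ n, N ≤ n → Γ.IsLarge j n := by
  have hs : 0 < Real.sin (Γ.angleBound j / 2) :=
    Real.sin_pos_of_pos_of_lt_pi (half_pos (Γ.angleBound_pos j)) (by
      have : Γ.angleBound j ≤ Real.pi / 2 := min_le_right _ _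
      linarith [Real.pi_pos])
  obtain ⟨N, hN⟩ := exists_nat_ge
    (max 1 (Γ.μ j) * Γ.δ j / (4 * Real.sin (Γ.angleBound j / 2)) + 1)
  refine ⟨max 2 N, fun n hn => ⟨(le_max_left _ _).trans hn, ?_⟩⟩
  have h : (N : ℝ) ≤ n := by exact_mod_cast (le_max_right _ _).trans hn
  have h2 : max 1 (Γ.μ j) * Γ.δ j / (4 * Real.sin (Γ.angleBound j / 2)) ≤ n - 1 := by linarith
  rw [div_le_iff₀ (by positivity)] at h2
  linarith

section large

variable {Γ} {j : ZMod k} {n : ℕ} (hn : Γ.IsLarge j n) {s u : ℝ}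
  (hs : s ∈ Icc ((n : ℝ) - 1) n) (hu : u ∈ Icc (0 : ℝ) 1)

include hn

lemma IsLarge.one_le_sub_one : (1 : ℝ) ≤ n - 1 := by
  have : (2 : ℝ) ≤ n := by exact_mod_cast hn.1
  linarith

include hs hu

lemma IsLarge.add_pos : 0 < s + u := by linarith [hn.one_le_sub_one, hs.1, hu.1]

lemma IsLarge.stripAngle_pos : 0 < Γ.stripAngle j s u :=
  div_pos (Γ.δ_pos j) (mul_pos two_pos (hn.add_pos hs hu))

lemma IsLarge.δ_eq : Γ.δ j = 2 * Γ.stripAngle j s u * (s + u) := by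
  have := hn.add_pos hs hu
  unfold stripAngle
  field_simp

lemma IsLarge.stripAngle_small :
    max 1 (Γ.μ j) * Γ.stripAngle j s u ≤ 2 * Real.sin (Γ.angleBound j / 2) := by
  have hκ : Γ.angleBound j ≤ Real.pi / 2 := min_le_right _ _
  have h0 : 0 < Real.sin (Γ.angleBound j / 2) :=
    Real.sin_pos_of_pos_of_lt_pi (half_pos (Γ.angleBound_pos j)) (by linarith [Real.pi_pos])
  have := hn.add_pos hs hu
  rw [stripAngle, ← mul_div_assoc, div_le_iff₀ (by positivity)]
  have h1 : (n - 1 : ℝ) * Real.sin (Γ.angleBound j / 2)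
      ≤ (s + u) * Real.sin (Γ.angleBound j / 2) := by
    gcongr; linarith [hs.1, hu.1]
  linarith [hn.2]

lemma IsLarge.abs_nodeOffset_le : |Γ.nodeOffset j n s u| ≤ Γ.stripAngle j s u := by
  have h := hn.stripAngle_pos hs hu
  rw [nodeOffset, abs_mul, abs_of_pos h]
  have : |2 * ((n : ℝ) - s) - 1| ≤ 1 := abs_le.2 ⟨by linarith [hs.2], by linarith [hs.1]⟩
  nlinarith

lemma IsLarge.outAngle_pos : 0 < Γ.outAngle j n s u :=
  crossAngle_pos (Γ.μ_pos j) (hn.abs_nodeOffset_le hs hu) (hn.stripAngle_pos hs hu)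
    (Γ.angleBound_pos j) (min_le_right _ _) (hn.stripAngle_small hs hu)

lemma IsLarge.outAngle_le : Γ.outAngle j n s u ≤ Γ.angleBound j :=
  crossAngle_le (Γ.μ_pos j) (hn.abs_nodeOffset_le hs hu) (hn.stripAngle_pos hs hu)
    (Γ.angleBound_pos j) (min_le_right _ _) (hn.stripAngle_small hs hu)

lemma IsLarge.abs_nodeOffset_le_outAngle : |Γ.nodeOffset j n s u| ≤ Γ.outAngle j n s u :=
  abs_le_crossAngle (Γ.μ_pos j) (hn.abs_nodeOffset_le hs hu) (hn.stripAngle_pos hs hu)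
    (Γ.angleBound_pos j) (min_le_right _ _) (hn.stripAngle_small hs hu)

lemma IsLarge.outU_mem : Γ.outU j n s u ∈ Icc (0 : ℝ) 1 := by
  have h := abs_le.1 (hn.abs_nodeOffset_le_outAngle hs hu)
  have h0 := hn.outAngle_pos hs hu
  refine ⟨div_nonneg (by linarith [h.1]) (by positivity), ?_⟩
  rw [outU, div_le_one (by positivity)]
  linarith [h.2]

lemma IsLarge.two_mul_outAngle_mul_outU :
    2 * Γ.outAngle j n s u * Γ.outU j n s u = Γ.nodeOffset j n s u + Γ.outAngle j n s u := by
  have h0 := hn.outAngle_pos hs hu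
  unfold outU
  field_simp

lemma IsLarge.stripAngle_out :
    Γ.stripAngle (j + 1) (Γ.outS j n s u) (Γ.outU j n s u) = Γ.outAngle j n s u := by
  have h0 := hn.outAngle_pos hs hu
  have h1 := Γ.δ_pos (j + 1)
  rw [stripAngle, outS, sub_add_cancel]
  field_simp

/-- The `n`-th iterate of the billiard map on the `(j, n)`-fundamental quadrilaterals: the first
`n - 1` chords stay in the arc `j` and the last one crosses the node. -/
lemma IsLarge.iterate_hasStripCoords {p : Phase} (hp : Γ.HasStripCoords j s u p) :
    Γ.HasStripCoords (j + 1) (Γ.outS j n s u) (Γ.outU j n s u) (Γ.billiardMap^[n] p) := by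
  have hθ := hn.stripAngle_pos hs hu
  have hδ := hn.δ_eq hs hu
  have hn2 := hn.one_le_sub_one
  have hx := hn.abs_nodeOffset_le hs hu
  have hsm := hn.stripAngle_small hs hu
  have hκ : Γ.angleBound j ≤ Real.pi / 2 := min_le_right _ _
  have hκ2 : Γ.angleBound j ≤ Γ.δ (j + 1) / 2 := min_le_left _ _
  have hθκ := le_of_small hθ (Γ.angleBound_pos j) hsm
  have ho := hn.outAngle_pos hs hu
  have ho' := hn.outAngle_le hs hu
  have hout : Γ.outAngle j n s u
      = crossAngle (Γ.μ j) (Γ.stripAngle j s u) (Γ.nodeOffset j n s u) := rfl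
  have hxe : Γ.nodeOffset j n s u = Γ.stripAngle j s u * (2 * (n - s) - 1) := rfl
  have hpi := Real.pi_pos
  obtain ⟨hp1, hp2⟩ := hp
  rw [HasStripCoords, hn.stripAngle_out hs hu, hn.two_mul_outAngle_mul_outU hs hu]
  generalize Γ.stripAngle j s u = θ at *
  generalize Γ.nodeOffset j n s u = x at *
  generalize Γ.outAngle j n s u = θ' at *
  obtain ⟨m, rfl⟩ : ∃ m, n = m + 1 := ⟨n - 1, by have := hn.1; omega⟩
  push_cast at hs hxe hn2
  have ht : 0 ≤ 2 * θ * u := mul_nonneg (by linarith) hu.1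
  have hit := Γ.billiardMap_iterate_of_same_arc hp1 (by rw [hp2]; exact hθ)
    (by rw [hp2]; linarith) ht m (by rw [hp2, hδ]; nlinarith [hs.1])
  have hq : Γ.billiardMap (Γ.billiardMap^[m] p)
      = (Γ.a (j + 1) + ((x + θ' : ℝ) : Real.Angle), ⟨θ', ho.le, by linarith⟩) := by
    rw [hit]
    have e : 2 * θ * u + 2 * m * p.2 = Γ.δ j + x - θ := by rw [hp2, hδ, hxe]; ring
    refine Γ.billiardMap_of_crossing hθ hx hsm ?_ ?_ hp2 hout rfl rfl
    · rw [← e, hp2]; positivity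
    · rw [e]
  rw [Function.iterate_succ_apply', hq]
  exact ⟨rfl, rfl⟩

end large

lemma IsLarge.continuousOn_stripAngle {Γ : CircularPolygon k} {j : ZMod k} {n : ℕ}
    (hn : Γ.IsLarge j n) :
    ContinuousOn (fun q : ℝ × ℝ => Γ.stripAngle j q.1 q.2)
      (Icc ((n : ℝ) - 1) n ×ˢ Icc (0 : ℝ) 1) := by
  unfold stripAngle
  refine ContinuousOn.div (by fun_prop) (by fun_prop) ?_
  rintro ⟨s, u⟩ ⟨hs, hu⟩
  exact (mul_pos two_pos (hn.add_pos hs hu)).ne'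

lemma IsLarge.continuousOn_nodeOffset {Γ : CircularPolygon k} {j : ZMod k} {n : ℕ}
    (hn : Γ.IsLarge j n) :
    ContinuousOn (fun q : ℝ × ℝ => Γ.nodeOffset j n q.1 q.2)
      (Icc ((n : ℝ) - 1) n ×ˢ Icc (0 : ℝ) 1) :=
  hn.continuousOn_stripAngle.mul (by fun_prop)

lemma IsLarge.continuousOn_outAngle {Γ : CircularPolygon k} {j : ZMod k} {n : ℕ}
    (hn : Γ.IsLarge j n) :
    ContinuousOn (fun q : ℝ × ℝ => Γ.outAngle j n q.1 q.2)
      (Icc ((n : ℝ) - 1) n ×ˢ Icc (0 : ℝ) 1) := by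
  have h := hn.continuousOn_stripAngle.prodMk hn.continuousOn_nodeOffset
  exact Continuous.comp_continuousOn (g := fun q : ℝ × ℝ => crossAngle (Γ.μ j) q.1 q.2)
    (f := fun q : ℝ × ℝ => (Γ.stripAngle j q.1 q.2, Γ.nodeOffset j n q.1 q.2))
    (continuous_crossAngle (Γ.μ j)) h

lemma IsLarge.continuousOn_outU {Γ : CircularPolygon k} {j : ZMod k} {n : ℕ}
    (hn : Γ.IsLarge j n) :
    ContinuousOn (fun q : ℝ × ℝ => Γ.outU j n q.1 q.2)
      (Icc ((n : ℝ) - 1) n ×ˢ Icc (0 : ℝ) 1) :=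
  (hn.continuousOn_nodeOffset.add hn.continuousOn_outAngle).div
    (continuousOn_const.mul hn.continuousOn_outAngle)
    fun _ hq => (mul_pos two_pos (hn.outAngle_pos hq.1 hq.2)).ne'

lemma IsLarge.continuousOn_outS {Γ : CircularPolygon k} {j : ZMod k} {n : ℕ}
    (hn : Γ.IsLarge j n) :
    ContinuousOn (fun q : ℝ × ℝ => Γ.outS j n q.1 q.2)
      (Icc ((n : ℝ) - 1) n ×ˢ Icc (0 : ℝ) 1) :=
  (continuousOn_const.div (continuousOn_const.mul hn.continuousOn_outAngle)
    fun _ hq => (mul_pos two_pos (hn.outAngle_pos hq.1 hq.2)).ne').sub hn.continuousOn_outU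

/-! ### Paths crossing a quadrilateral -/

/-- A continuous function that goes from below `lo` to above `hi` has a restriction that goes
from `lo` to `hi` and stays strictly between them at intermediate times. -/
lemma _root_.ContinuousOn.exists_crossing {f : ℝ → ℝ} {a b lo hi : ℝ} (hab : a ≤ b)
    (hf : ContinuousOn f (Icc a b)) (hlh : lo < hi) (ha : f a ≤ lo) (hb : hi ≤ f b) :
    ∃ s t, a ≤ s ∧ s < t ∧ t ≤ b ∧ f s = lo ∧ f t = hi ∧ ∀ r ∈ Ioo s t, lo < f r ∧ f r < hi := by
  have hclosed : IsClosed (Icc a b ∩ f ⁻¹' Ici hi) := hf.preimage_isClosed_of_isClosed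
    isClosed_Icc isClosed_Ici
  have hcomp : IsCompact (Icc a b ∩ f ⁻¹' Ici hi) :=
    isCompact_Icc.of_isClosed_subset hclosed inter_subset_left
  obtain ⟨t, ⟨htI, hth⟩, htmin⟩ := hcomp.exists_isLeast ⟨b, right_mem_Icc.2 hab, hb⟩
  have hf' : ContinuousOn f (Icc a t) := hf.mono (Icc_subset_Icc_right htI.2)
  have hclosed' : IsClosed (Icc a t ∩ f ⁻¹' Iic lo) := hf'.preimage_isClosed_of_isClosed
    isClosed_Icc isClosed_Iic
  have hcomp' : IsCompact (Icc a t ∩ f ⁻¹' Iic lo) :=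
    isCompact_Icc.of_isClosed_subset hclosed' inter_subset_left
  obtain ⟨s, ⟨hsI, hsl⟩, hsmax⟩ := hcomp'.exists_isGreatest ⟨a, left_mem_Icc.2 htI.1, ha⟩
  have hsl : f s ≤ lo := hsl
  have hth : hi ≤ f t := hth
  have hst : s < t := hsI.2.lt_of_ne fun h => by rw [h] at hsl; linarith
  have hmid : ∀ r ∈ Ioo s t, lo < f r ∧ f r < hi := by
    intro r hr
    refine ⟨?_, ?_⟩ <;> by_contra! h
    · exact absurd (hsmax ⟨⟨hsI.1.trans hr.1.le, hr.2.le⟩, h⟩) (not_le.2 hr.1)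
    · exact absurd (htmin ⟨⟨hsI.1.trans hr.1.le, hr.2.le.trans htI.2⟩, h⟩) (not_le.2 hr.2)
  refine ⟨s, t, hsI.1, hst, htI.2, ?_, ?_, hmid⟩
  · refine le_antisymm hsl ?_
    -- by the intermediate value theorem, `lo` is attained in `[s, t]`, hence at `s`
    obtain ⟨r, hr, hfr⟩ := intermediate_value_Icc hst.le (hf'.mono (Icc_subset_Icc_left hsI.1))
      (show lo ∈ Icc (f s) (f t) from ⟨hsl, by linarith⟩)
    have : r ≤ s := hsmax ⟨⟨hsI.1.trans hr.1, hr.2⟩, hfr.le⟩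
    rw [← hfr, le_antisymm this hr.1]
  · refine le_antisymm ?_ hth
    obtain ⟨r, hr, hfr⟩ := intermediate_value_Icc hst.le (hf'.mono (Icc_subset_Icc_left hsI.1))
      (show hi ∈ Icc (f s) (f t) from ⟨by linarith, hth⟩)
    have : t ≤ r := htmin ⟨⟨hsI.1.trans hr.1, hr.2.trans htI.2⟩, hfr.ge⟩
    rw [← hfr, le_antisymm hr.2 this]

lemma level_zero {s₀ s₁ : ℝ} {p : Square} (h : p ∈ Square.base) : level s₀ s₁ p = s₁ := by
  have h : (p.2 : ℝ) = 0 := h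
  simp [level, h]

lemma level_one {s₀ s₁ : ℝ} {p : Square} (h : p ∈ Square.top) : level s₀ s₁ p = s₀ := by
  have h : (p.2 : ℝ) = 1 := h
  simp [level, h]

lemma level_le {s₀ s₁ : ℝ} (h : s₀ < s₁) (p : Square) : level s₀ s₁ p ≤ s₁ := by
  unfold level
  nlinarith [p.2.2.1]

lemma quadParam_hasStripCoords (j : ZMod k) {s₀ s₁ : ℝ} (h₀ : 1 ≤ s₀) (h₁ : s₀ < s₁)
    (p : Square) :
    Γ.HasStripCoords j (level s₀ s₁ p) p.1 (Γ.quadParam j s₀ s₁ h₀ h₁ p) := by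
  have := level_add_pos h₀ h₁ p
  refine ⟨?_, rfl⟩
  change _ + _ = _
  congr 2
  unfold stripAngle
  field_simp

lemma HasStripCoords.eq {Γ : CircularPolygon k} {j : ZMod k} {s u : ℝ} {p q : Phase}
    (hp : Γ.HasStripCoords j s u p) (hq : Γ.HasStripCoords j s u q) : p = q :=
  Prod.ext (hp.1.trans hq.1.symm) (Subtype.ext (hp.2.trans hq.2.symm))

/-- The point of the square with coordinates `u` and `s = s₁ - (s₁ - s₀) v`. The projections on
`[0, 1]` make it a total continuous function. -/
noncomputable def squarePoint (s₀ s₁ s u : ℝ) : Square :=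
  (projIcc 0 1 zero_le_one u, projIcc 0 1 zero_le_one ((s₁ - s) / (s₁ - s₀)))

lemma continuous_squarePoint (s₀ s₁ : ℝ) :
    Continuous fun q : ℝ × ℝ => squarePoint s₀ s₁ q.1 q.2 := by
  unfold squarePoint
  have := continuous_projIcc (a := (0 : ℝ)) (b := 1) (h := zero_le_one)
  fun_prop

lemma squarePoint_fst {s₀ s₁ s u : ℝ} (hu : u ∈ Icc (0 : ℝ) 1) :
    ((squarePoint s₀ s₁ s u).1 : ℝ) = u := by
  rw [squarePoint, projIcc_of_mem _ hu]

lemma level_squarePoint {s₀ s₁ s u : ℝ} (h₁ : s₀ < s₁) (hs : s ∈ Icc s₀ s₁) :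
    level s₀ s₁ (squarePoint s₀ s₁ s u) = s := by
  have h : 0 < s₁ - s₀ := sub_pos.2 h₁
  have hv : (s₁ - s) / (s₁ - s₀) ∈ Icc (0 : ℝ) 1 :=
    ⟨div_nonneg (by linarith [hs.2]) h.le, by rw [div_le_one h]; linarith [hs.1]⟩
  rw [squarePoint, level, projIcc_of_mem _ hv]
  field_simp
  ring

lemma mem_base_iff {s₀ s₁ : ℝ} (h₁ : s₀ < s₁) (p : Square) :
    p ∈ Square.base ↔ level s₀ s₁ p = s₁ := by
  refine ⟨level_zero, fun h => ?_⟩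
  have h' : (s₁ - s₀) * (p.2 : ℝ) = 0 := by unfold level at h; linarith
  exact (mul_eq_zero.1 h').resolve_left (sub_pos.2 h₁).ne'

lemma mem_top_iff {s₀ s₁ : ℝ} (h₁ : s₀ < s₁) (p : Square) :
    p ∈ Square.top ↔ level s₀ s₁ p = s₀ := by
  refine ⟨level_one, fun h => ?_⟩
  have h' : (s₁ - s₀) * (p.2 : ℝ) = (s₁ - s₀) * 1 := by unfold level at h; linarith
  exact mul_left_cancel₀ (sub_pos.2 h₁).ne' h'

lemma isVerticalPath_of_hasStripCoords {j : ZMod k} {s₀ s₁ : ℝ} (h₀ : 1 ≤ s₀) (h₁ : s₀ < s₁)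
    {σ υ : ℝ → ℝ} {g : ℝ → Phase} {s t : ℝ} (hst : s < t)
    (hσ : ContinuousOn σ (Icc s t)) (hυ : ContinuousOn υ (Icc s t))
    (hυ' : ∀ r ∈ Icc s t, υ r ∈ Icc (0 : ℝ) 1)
    (hg : ∀ r ∈ Icc s t, Γ.HasStripCoords j (σ r) (υ r) (g r))
    (hend : (σ s = s₀ ∧ σ t = s₁) ∨ (σ s = s₁ ∧ σ t = s₀))
    (hmid : ∀ r ∈ Ioo s t, s₀ < σ r ∧ σ r < s₁) :
    IsVerticalPath (Γ.quadCell j s₀ s₁ h₀ h₁) g s t := by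
  have hσ' : ∀ r ∈ Icc s t, σ r ∈ Icc s₀ s₁ := by
    intro r hr
    rcases hr.1.eq_or_lt with rfl | h
    · rcases hend with h | h <;> rw [h.1] <;> exact ⟨by linarith, by linarith⟩
    rcases hr.2.eq_or_lt with rfl | h'
    · rcases hend with h | h <;> rw [h.2] <;> exact ⟨by linarith, by linarith⟩
    exact ⟨(hmid r ⟨h, h'⟩).1.le, (hmid r ⟨h, h'⟩).2.le⟩
  set q : ℝ → Square := fun r => squarePoint s₀ s₁ (σ r) (υ r) with hq
  have hql : ∀ r ∈ Icc s t, level s₀ s₁ (q r) = σ r := fun r hr =>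
    level_squarePoint h₁ (hσ' r hr)
  have hgq : ∀ r ∈ Icc s t, g r = (Γ.quadCell j s₀ s₁ h₀ h₁).param (q r) := by
    intro r hr
    have h := Γ.quadParam_hasStripCoords j h₀ h₁ (q r)
    rw [hql r hr, squarePoint_fst (hυ' r hr)] at h
    exact (hg r hr).eq h
  have hs := left_mem_Icc.2 hst.le
  have ht := right_mem_Icc.2 hst.le
  refine ⟨hst, ?_, fun r hr => ⟨q r, (hgq r hr).symm⟩, ?_, ?_⟩
  · refine ContinuousOn.congr ?_ hgq
    exact (Γ.quadCell j s₀ s₁ h₀ h₁).continuous_param.comp_continuousOn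
      ((continuous_squarePoint s₀ s₁).comp_continuousOn (hσ.prodMk hυ))
  · rw [hgq s hs, hgq t ht]
    rcases hend with h | h
    · exact .inr ⟨mem_image_of_mem _ ((mem_top_iff h₁ _).2 ((hql s hs).trans h.1)),
        mem_image_of_mem _ ((mem_base_iff h₁ _).2 ((hql t ht).trans h.2))⟩
    · exact .inl ⟨mem_image_of_mem _ ((mem_base_iff h₁ _).2 ((hql s hs).trans h.1)),
        mem_image_of_mem _ ((mem_top_iff h₁ _).2 ((hql t ht).trans h.2))⟩
  · intro r hr
    have hr' := Ioo_subset_Icc_self hr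
    have hinj := (Γ.quadCell j s₀ s₁ h₀ h₁).injective_param
    rw [hgq r hr', OrientedCell.horizontal, OrientedCell.base, OrientedCell.top, mem_union,
      hinj.mem_set_image, hinj.mem_set_image, mem_base_iff h₁, mem_top_iff h₁, hql r hr']
    rintro (h | h)
    · exact (hmid r hr).2.ne h
    · exact (hmid r hr).1.ne' h

/-- The `n`-th iterate stretches a part of a fundamental quadrilateral to a part of a fundamental
quadrilateral of the next arc as soon as the images of the two horizontal sides lie on opposite
sides of the target. -/
lemma IsLarge.stretches {Γ : CircularPolygon k} {j : ZMod k} {n : ℕ} (hn : Γ.IsLarge j n)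
    {s₀ s₁ t₀ t₁ : ℝ} (h₀ : 1 ≤ s₀) (h₁ : s₀ < s₁) (h₀' : 1 ≤ t₀) (h₁' : t₀ < t₁)
    (hlo : (n : ℝ) - 1 ≤ s₀) (hhi : s₁ ≤ n)
    (hends : (∀ u ∈ Icc (0 : ℝ) 1, Γ.outS j n s₀ u ≤ t₀ ∧ t₁ ≤ Γ.outS j n s₁ u) ∨
      (∀ u ∈ Icc (0 : ℝ) 1, Γ.outS j n s₁ u ≤ t₀ ∧ t₁ ≤ Γ.outS j n s₀ u)) :
    Stretches (Γ.billiardMap^[n]) (Γ.quadCell j s₀ s₁ h₀ h₁)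
      (Γ.quadCell (j + 1) t₀ t₁ h₀' h₁') := by
  rintro γ a b ⟨hab, hγ, hcar, hend, -⟩
  have hemb := (Γ.quadCell j s₀ s₁ h₀ h₁).continuous_param.isClosedEmbedding
    (Γ.quadCell j s₀ s₁ h₀ h₁).injective_param
  have : Nonempty Square := ⟨Square.mid⟩
  choose! p hp using hcar
  have hpc : ContinuousOn p (Icc a b) := by
    rw [hemb.isInducing.continuousOn_iff]
    exact hγ.congr hp
  have hl : ∀ r, level s₀ s₁ (p r) ∈ Icc ((n : ℝ) - 1) n := fun r =>
    ⟨hlo.trans (level_ge h₁ _), (level_le h₁ _).trans hhi⟩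
  have hc : ContinuousOn (fun r => (level s₀ s₁ (p r), ((p r).1 : ℝ))) (Icc a b) := by
    have hlev := continuous_level s₀ s₁
    have : Continuous fun q : Square => (level s₀ s₁ q, (q.1 : ℝ)) := by fun_prop
    exact this.comp_continuousOn hpc
  have hmaps : MapsTo (fun r => (level s₀ s₁ (p r), ((p r).1 : ℝ))) (Icc a b)
      (Icc ((n : ℝ) - 1) n ×ˢ Icc (0 : ℝ) 1) := fun r _ => ⟨hl r, (p r).1.2⟩
  have hS := hn.continuousOn_outS.comp hc hmaps
  have hU := hn.continuousOn_outU.comp hc hmaps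
  set σ : ℝ → ℝ := fun r => Γ.outS j n (level s₀ s₁ (p r)) (p r).1
  set υ : ℝ → ℝ := fun r => Γ.outU j n (level s₀ s₁ (p r)) (p r).1
  have ha := left_mem_Icc.2 hab.le
  have hb := right_mem_Icc.2 hab.le
  have hσ : (σ a ≤ t₀ ∧ t₁ ≤ σ b) ∨ (σ b ≤ t₀ ∧ t₁ ≤ σ a) := by
    rw [← hp a ha, ← hp b hb, OrientedCell.base, OrientedCell.top, hemb.injective.mem_set_image,
      hemb.injective.mem_set_image, hemb.injective.mem_set_image, hemb.injective.mem_set_image,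
      mem_base_iff h₁, mem_top_iff h₁, mem_base_iff h₁, mem_top_iff h₁] at hend
    simp only [σ]
    rcases hend with ⟨e₁, e₂⟩ | ⟨e₁, e₂⟩ <;> rw [e₁, e₂] <;> rcases hends with h | h
    · exact .inr ⟨(h _ (p b).1.2).1, (h _ (p a).1.2).2⟩
    · exact .inl ⟨(h _ (p a).1.2).1, (h _ (p b).1.2).2⟩
    · exact .inl ⟨(h _ (p a).1.2).1, (h _ (p b).1.2).2⟩
    · exact .inr ⟨(h _ (p b).1.2).1, (h _ (p a).1.2).2⟩
  have hcoords : ∀ r ∈ Icc a b,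
      Γ.HasStripCoords (j + 1) (σ r) (υ r) ((Γ.billiardMap^[n] ∘ γ) r) := by
    intro r hr
    rw [Function.comp_apply, ← hp r hr]
    exact hn.iterate_hasStripCoords (hl r) (p r).1.2 (Γ.quadParam_hasStripCoords j h₀ h₁ (p r))
  obtain ⟨s, t, hs, hst, ht, hst', hmid⟩ : ∃ s t, a ≤ s ∧ s < t ∧ t ≤ b ∧
      ((σ s = t₀ ∧ σ t = t₁) ∨ (σ s = t₁ ∧ σ t = t₀)) ∧ ∀ r ∈ Ioo s t, t₀ < σ r ∧ σ r < t₁ := by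
    rcases hσ with h | h
    · obtain ⟨s, t, hs, hst, ht, e₁, e₂, hmid⟩ := hS.exists_crossing hab.le h₁' h.1 h.2
      exact ⟨s, t, hs, hst, ht, .inl ⟨e₁, e₂⟩, hmid⟩
    · obtain ⟨s, t, hs, hst, ht, e₁, e₂, hmid⟩ := hS.neg.exists_crossing hab.le (neg_lt_neg h₁')
        (neg_le_neg h.2) (neg_le_neg h.1)
      refine ⟨s, t, hs, hst, ht, .inr ⟨neg_injective e₁, neg_injective e₂⟩, fun r hr => ?_⟩
      exact ⟨neg_lt_neg_iff.1 (hmid r hr).2, neg_lt_neg_iff.1 (hmid r hr).1⟩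
  have hsub : Icc s t ⊆ Icc a b := Icc_subset_Icc hs ht
  exact ⟨s, t, hs, hst, ht, Γ.isVerticalPath_of_hasStripCoords h₀' h₁' hst (hS.mono hsub)
    (hU.mono hsub) (fun r _ => hn.outU_mem (hl r) (p r).1.2) (fun r hr => hcoords r (hsub hr))
    hst' hmid⟩

/-! ### Images of the horizontal sides -/

section ends

variable {Γ} {j : ZMod k} {n : ℕ} (hn : Γ.IsLarge j n) {u : ℝ} (hu : u ∈ Icc (0 : ℝ) 1)

include hn hu

lemma IsLarge.outAngle_of_abs_eq {s : ℝ} (hs : s ∈ Icc ((n : ℝ) - 1) n)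
    (h : |Γ.nodeOffset j n s u| = Γ.stripAngle j s u) :
    Γ.outAngle j n s u = Γ.stripAngle j s u :=
  crossAngle_of_abs_eq (hn.stripAngle_pos hs hu) (Γ.angleBound_pos j) (min_le_right _ _)
    (hn.stripAngle_small hs hu) h

lemma IsLarge.outS_base : Γ.outS j n n u = Γ.δ (j + 1) / Γ.δ j * (n + u) := by
  have hs : (n : ℝ) ∈ Icc ((n : ℝ) - 1) n := ⟨by linarith, le_rfl⟩
  have hθ := hn.stripAngle_pos hs hu
  have hx : Γ.nodeOffset j n n u = -Γ.stripAngle j n u := by unfold nodeOffset; ring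
  have ho := hn.outAngle_of_abs_eq hu hs (by rw [hx, abs_neg, abs_of_pos hθ])
  have hδ := Γ.δ_pos j
  have hp := hn.add_pos hs hu
  rw [outS, outU, ho, hx, neg_add_cancel, zero_div, sub_zero, stripAngle]
  field_simp

lemma IsLarge.outS_top : Γ.outS j n (n - 1) u = Γ.δ (j + 1) / Γ.δ j * (n - 1 + u) - 1 := by
  have hs : (n : ℝ) - 1 ∈ Icc ((n : ℝ) - 1) n := ⟨le_rfl, by linarith⟩
  have hθ := hn.stripAngle_pos hs hu
  have hx : Γ.nodeOffset j n (n - 1) u = Γ.stripAngle j (n - 1) u := by unfold nodeOffset; ring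
  have ho := hn.outAngle_of_abs_eq hu hs (by rw [hx, abs_of_pos hθ])
  have hδ := Γ.δ_pos j
  have hp := hn.add_pos hs hu
  rw [outS, outU, ho, hx, ← two_mul, div_self (by positivity), stripAngle]
  field_simp

lemma IsLarge.outS_mid :
    Γ.outS j n (n - 1 / 2) u = Γ.δ (j + 1) / (2 * Γ.outAngle j n (n - 1 / 2) u) - 1 / 2 := by
  have hs : (n : ℝ) - 1 / 2 ∈ Icc ((n : ℝ) - 1) n := ⟨by linarith, by linarith⟩
  have ho := hn.outAngle_pos hs hu
  have hx : Γ.nodeOffset j n (n - 1 / 2) u = 0 := by unfold nodeOffset; ring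
  rw [outS, outU, hx, zero_add]
  generalize Γ.outAngle j n (n - 1 / 2) u = θ at *
  field_simp

end ends

end CircularPolygon

/-- The level of the horizontal side that the half `ς` shares with the whole fundamental
quadrilateral of index `n`. -/
noncomputable def Half.outer (n : ℕ) : Half → ℝ
  | .minus => n
  | .plus => n - 1

/-- The smallest level of the half `ς` of the fundamental quadrilaterals of index `n`. -/
noncomputable def Half.lo (n : ℕ) : Half → ℝ
  | .minus => n - 1 / 2
  | .plus => n - 1

/-- The largest level of the half `ς` of the fundamental quadrilaterals of index `n`. -/
noncomputable def Half.hi (n : ℕ) : Half → ℝ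
  | .minus => n
  | .plus => n - 1 / 2

namespace Half

variable (n : ℕ) (ς : Half)

lemma hi_eq : ς.hi n = ς.lo n + 1 / 2 := by cases ς <;> simp [hi, lo]; ring

lemma le_lo : (n : ℝ) - 1 ≤ ς.lo n := by
  cases ς <;> simp only [lo] <;> linarith

lemma hi_le : ς.hi n ≤ n := by cases ς <;> simp [hi]

/-- The half and the index of a quadrilateral are determined by a level in its interior. -/
lemma eq_of_level {m n : ℕ} {ς ς' : Half} {s : ℝ} (h₁ : ς.lo m < s) (h₂ : s < ς.hi m)
    (h₁' : ς'.lo n < s) (h₂' : s < ς'.hi n) : m = n ∧ ς = ς' := by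
  have a1 := le_lo m ς
  have a2 := hi_le m ς
  have a3 := le_lo n ς'
  have a4 := hi_le n ς'
  have b1 : (m : ℝ) < n + 1 := by linarith
  have b2 : (n : ℝ) < m + 1 := by linarith
  have c1 : m < n + 1 := by exact_mod_cast b1
  have c2 : n < m + 1 := by exact_mod_cast b2
  obtain rfl : m = n := by omega
  refine ⟨rfl, ?_⟩
  cases ς <;> cases ς' <;> simp only [lo, hi] at * <;> first | rfl | (exfalso; linarith)

end Half

namespace CircularPolygon

variable {k : ℕ} [NeZero k] (Γ : CircularPolygon k)

lemma fundQuad_eq (j : ZMod k) (n : ℕ) (hn : 2 ≤ n) (ς : Half) (h₀ : 1 ≤ ς.lo n)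
    (h₁ : ς.lo n < ς.hi n) : Γ.fundQuad j n hn ς = Γ.quadCell j (ς.lo n) (ς.hi n) h₀ h₁ := by
  cases ς <;> rfl

/-- Either the images of the outer levels lie below and the images of the middle level lie above
the fundamental quadrilaterals of the next arc with indices `n'` such that `(n, n') ∈ Υ j`, or the
other way round, according to which of the two consecutive arcs has the larger radius. -/
lemma IsLarge.outS_ends {Γ : CircularPolygon k} {j : ZMod k} {n : ℕ} (hn : Γ.IsLarge j n) :
    (∀ u ∈ Icc (0 : ℝ) 1, (∀ ς : Half, Γ.outS j n (ς.outer n) u ≤ Γ.αMinus j * (n + 1)) ∧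
      Γ.αPlus j * (n - 1) - 1 ≤ Γ.outS j n (n - 1 / 2) u) ∨
    (∀ u ∈ Icc (0 : ℝ) 1, (∀ ς : Half, Γ.αPlus j * (n - 1) - 1 ≤ Γ.outS j n (ς.outer n) u) ∧
      Γ.outS j n (n - 1 / 2) u ≤ Γ.αMinus j * (n + 1)) := by
  have hδ := Γ.δ_pos j
  have hδ' := Γ.δ_pos (j + 1)
  have hμ := Γ.μ_pos j
  have hn1 := hn.one_le_sub_one
  have hs : (n : ℝ) - 1 / 2 ∈ Icc ((n : ℝ) - 1) n := ⟨by linarith, by linarith⟩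
  have hx : ∀ u, Γ.nodeOffset j n (n - 1 / 2) u = 0 := fun u => by unfold nodeOffset; ring
  have hd : 0 < Γ.δ (j + 1) / Γ.δ j := by positivity
  have hdm : 0 < Γ.δ (j + 1) / (Γ.δ j * Γ.μ j) := by positivity
  rcases le_total (Γ.μ j) 1 with h | h
  · left
    intro u hu
    have hu0 := hu.1
    have hu1 := hu.2
    rw [αMinus, αPlus, max_eq_left h, min_eq_right h, mul_one]
    refine ⟨fun ς => ?_, ?_⟩
    · cases ς
      · rw [Half.outer, hn.outS_base hu]
        gcongr
      · rw [Half.outer, hn.outS_top hu]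
        have : Γ.δ (j + 1) / Γ.δ j * (n - 1 + u) ≤ Γ.δ (j + 1) / Γ.δ j * (n + 1) := by
          gcongr; linarith
        linarith
    · rw [hn.outS_mid hu]
      have ho := hn.outAngle_pos hs hu
      have hle : Γ.outAngle j n (n - 1 / 2) u ≤ Γ.μ j * Γ.stripAngle j (n - 1 / 2) u := by
        rw [outAngle, hx]
        exact crossAngle_zero_le hμ (hn.stripAngle_pos hs hu) (Γ.angleBound_pos j)
          (min_le_right _ _) (hn.stripAngle_small hs hu) h
      have hp := hn.add_pos hs hu
      have e : Γ.δ (j + 1) / (2 * (Γ.μ j * Γ.stripAngle j (n - 1 / 2) u))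
          = Γ.δ (j + 1) / (Γ.δ j * Γ.μ j) * (n - 1 / 2 + u) := by
        unfold stripAngle; field_simp
      have h1 : Γ.δ (j + 1) / (2 * (Γ.μ j * Γ.stripAngle j (n - 1 / 2) u))
          ≤ Γ.δ (j + 1) / (2 * Γ.outAngle j n (n - 1 / 2) u) := by gcongr
      have h2 : Γ.δ (j + 1) / (Γ.δ j * Γ.μ j) * (n - 1)
          ≤ Γ.δ (j + 1) / (Γ.δ j * Γ.μ j) * (n - 1 / 2 + u) := by gcongr; linarith
      linarith
  · right
    intro u hu
    have hu0 := hu.1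
    have hu1 := hu.2
    rw [αMinus, αPlus, max_eq_right h, min_eq_left h, mul_one]
    refine ⟨fun ς => ?_, ?_⟩
    · cases ς
      · rw [Half.outer, hn.outS_base hu]
        have : Γ.δ (j + 1) / Γ.δ j * (n - 1) ≤ Γ.δ (j + 1) / Γ.δ j * (n + u) := by
          gcongr; linarith
        linarith
      · rw [Half.outer, hn.outS_top hu]
        gcongr; linarith
    · rw [hn.outS_mid hu]
      have hθ := hn.stripAngle_pos hs hu
      have hle : Γ.μ j * Γ.stripAngle j (n - 1 / 2) u ≤ Γ.outAngle j n (n - 1 / 2) u := by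
        rw [outAngle, hx]
        exact le_crossAngle_zero hμ hθ (Γ.angleBound_pos j)
          (min_le_right _ _) (hn.stripAngle_small hs hu) h
      have hp := hn.add_pos hs hu
      have e : Γ.δ (j + 1) / (2 * (Γ.μ j * Γ.stripAngle j (n - 1 / 2) u))
          = Γ.δ (j + 1) / (Γ.δ j * Γ.μ j) * (n - 1 / 2 + u) := by
        unfold stripAngle; field_simp
      have h1 : Γ.δ (j + 1) / (2 * Γ.outAngle j n (n - 1 / 2) u)
          ≤ Γ.δ (j + 1) / (2 * (Γ.μ j * Γ.stripAngle j (n - 1 / 2) u)) := by gcongr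
      have h2 : Γ.δ (j + 1) / (Γ.δ j * Γ.μ j) * (n - 1 / 2 + u)
          ≤ Γ.δ (j + 1) / (Γ.δ j * Γ.μ j) * (n + 1) := by gcongr; linarith
      linarith

/-- The same fact for the two horizontal sides of one half of a fundamental quadrilateral. -/
lemma IsLarge.outS_sides {Γ : CircularPolygon k} {j : ZMod k} {n : ℕ} (hn : Γ.IsLarge j n)
    (ς : Half) :
    (∀ u ∈ Icc (0 : ℝ) 1, Γ.outS j n (ς.lo n) u ≤ Γ.αMinus j * (n + 1) ∧
      Γ.αPlus j * (n - 1) - 1 ≤ Γ.outS j n (ς.hi n) u) ∨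
    (∀ u ∈ Icc (0 : ℝ) 1, Γ.outS j n (ς.hi n) u ≤ Γ.αMinus j * (n + 1) ∧
      Γ.αPlus j * (n - 1) - 1 ≤ Γ.outS j n (ς.lo n) u) := by
  rcases hn.outS_ends with h | h <;> cases ς
  · exact .inr fun u hu => ⟨(h u hu).1 .minus, (h u hu).2⟩
  · exact .inl fun u hu => ⟨(h u hu).1 .plus, (h u hu).2⟩
  · exact .inl fun u hu => ⟨(h u hu).2, (h u hu).1 .minus⟩
  · exact .inr fun u hu => ⟨(h u hu).2, (h u hu).1 .plus⟩

/-- A positive number that bounds from below the distances from `c` to the larger natural numbers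
and from `d` to the smaller ones. -/
lemma _root_.exists_natCast_gap (c d : ℝ) :
    ∃ G > 0, ∀ m : ℕ, (c < m → c + G ≤ m) ∧ ((m : ℝ) < d → m ≤ d - G) := by
  refine ⟨min (⌊c⌋ + 1 - c) (d - (⌈d⌉ - 1)), lt_min ?_ ?_, fun m => ⟨fun h => ?_, fun h => ?_⟩⟩
  · linarith [Int.lt_floor_add_one c]
  · linarith [Int.ceil_lt_add_one d]
  · have h1 : ⌊c⌋ + 1 ≤ (m : ℤ) := Int.floor_lt.2 (by exact_mod_cast h)
    have h2 : (⌊c⌋ : ℝ) + 1 ≤ m := by exact_mod_cast h1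
    linarith [min_le_left (⌊c⌋ + 1 - c) (d - (⌈d⌉ - 1))]
  · have h1 : (m : ℤ) < ⌈d⌉ := Int.lt_ceil.2 (by exact_mod_cast h)
    have h2 : (m : ℝ) + 1 ≤ ⌈d⌉ := by exact_mod_cast h1
    linarith [min_le_right (⌊c⌋ + 1 - c) (d - (⌈d⌉ - 1))]

/-- The `n`-th iterate stretches a half of the `(j, n)`-fundamental quadrilateral, shrunk by `ε`
at both horizontal sides, across the whole quadrilaterals of the next arc with indices `n'` such
that `(n, n') ∈ Ξ j`. One `ε` serves for all `n'`, because the distance from the bounds in the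
definition of `Ξ j` to the integers strictly between them is bounded below. -/
lemma IsLarge.exists_shrink {Γ : CircularPolygon k} {j : ZMod k} {n : ℕ} (hn : Γ.IsLarge j n) :
    ∃ ε : ℝ, 0 < ε ∧ ε ≤ 1 / 8 ∧ ∀ n' : ℕ, Γ.αMinus j * n + Γ.βMinus j < n' →
      (n' : ℝ) < Γ.αPlus j * n - Γ.βPlus j → ∀ ς : Half,
      (∀ u ∈ Icc (0 : ℝ) 1, Γ.outS j n (ς.lo n + ε) u ≤ n' - 1 ∧
        (n' : ℝ) ≤ Γ.outS j n (ς.hi n - ε) u) ∨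
      (∀ u ∈ Icc (0 : ℝ) 1, Γ.outS j n (ς.hi n - ε) u ≤ n' - 1 ∧
        (n' : ℝ) ≤ Γ.outS j n (ς.lo n + ε) u) := by
  obtain ⟨G, hG, hgap⟩ := exists_natCast_gap (Γ.αMinus j * n + Γ.βMinus j)
    (Γ.αPlus j * n - Γ.βPlus j)
  have huc := (isCompact_Icc.prod isCompact_Icc).uniformContinuousOn_of_continuous
    hn.continuousOn_outS
  obtain ⟨η, hη, hclose⟩ := Metric.uniformContinuousOn_iff.1 huc G hG
  refine ⟨min (1 / 8) (η / 2), by positivity, min_le_left _ _, fun n' h₁ h₂ ς => ?_⟩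
  have e8 := min_le_left (1 / 8) (η / 2)
  have eη := min_le_right (1 / 8) (η / 2)
  have e0 : 0 < min (1 / 8) (η / 2) := by positivity
  generalize min (1 / 8) (η / 2) = ε at *
  have g₁ := (hgap n').1 h₁
  have g₂ := (hgap n').2 h₂
  rw [βMinus] at g₁
  rw [βPlus] at g₂
  have hlo := Half.le_lo n ς
  have hhi := Half.hi_le n ς
  have hlh := Half.hi_eq n ς
  have near : ∀ u ∈ Icc (0 : ℝ) 1,
      |Γ.outS j n (ς.lo n + ε) u - Γ.outS j n (ς.lo n) u| < G ∧
      |Γ.outS j n (ς.hi n - ε) u - Γ.outS j n (ς.hi n) u| < G := by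
    intro u hu
    have ε1 : |ε| < η := by rw [abs_of_pos e0]; linarith
    constructor
    · refine hclose (ς.lo n + ε, u) ⟨⟨by linarith, by linarith⟩, hu⟩ (ς.lo n, u)
        ⟨⟨by linarith, by linarith⟩, hu⟩ ?_
      rw [dist_prod_same_right, Real.dist_eq, add_sub_cancel_left]
      exact ε1
    · refine hclose (ς.hi n - ε, u) ⟨⟨by linarith, by linarith⟩, hu⟩ (ς.hi n, u)
        ⟨⟨by linarith, by linarith⟩, hu⟩ ?_
      rw [dist_prod_same_right, Real.dist_eq, sub_sub_cancel_left, abs_neg]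
      exact ε1
  rcases hn.outS_sides ς with h | h
  · refine .inl fun u hu => ?_
    have h3 := abs_lt.1 (near u hu).1
    have h4 := abs_lt.1 (near u hu).2
    exact ⟨by linarith [(h u hu).1, h3.2], by linarith [(h u hu).2, h4.1]⟩
  · refine .inr fun u hu => ?_
    have h3 := abs_lt.1 (near u hu).1
    have h4 := abs_lt.1 (near u hu).2
    exact ⟨by linarith [(h u hu).1, h4.2], by linarith [(h u hu).2, h3.1]⟩

lemma IsLarge.stretches_fundQuad {Γ : CircularPolygon k} {j : ZMod k} {n n' : ℕ}
    (hn : Γ.IsLarge j n) (hn' : 2 ≤ n') (h₁ : Γ.αMinus j * n + Γ.βMinus j ≤ n')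
    (h₂ : (n' : ℝ) ≤ Γ.αPlus j * n - Γ.βPlus j) (ς ς' : Half) :
    Stretches (Γ.billiardMap^[n]) (Γ.fundQuad j n hn.1 ς) (Γ.fundQuad (j + 1) n' hn' ς') := by
  have a1 := Half.le_lo n ς
  have a2 := Half.hi_eq n ς
  have a3 := Half.hi_le n ς
  have b1 := Half.le_lo n' ς'
  have b2 := Half.hi_eq n' ς'
  have b3 := Half.hi_le n' ς'
  have hn1 := hn.one_le_sub_one
  have hn1' := CircularPolygon.one_le_sub_one hn'
  rw [βMinus] at h₁
  rw [βPlus] at h₂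
  rw [Γ.fundQuad_eq j n hn.1 ς (by linarith) (by linarith),
    Γ.fundQuad_eq (j + 1) n' hn' ς' (by linarith) (by linarith)]
  refine hn.stretches _ _ _ _ a1 a3 ?_
  rcases hn.outS_sides ς with h | h
  · exact .inl fun u hu => ⟨by linarith [(h u hu).1], by linarith [(h u hu).2]⟩
  · exact .inr fun u hu => ⟨by linarith [(h u hu).1], by linarith [(h u hu).2]⟩

/-! ### Slabs and the extended singularity set -/

lemma quadCell_isStrictHorizontalSlab (j : ZMod k) {s₀ s₁ t₀ t₁ : ℝ} (h₀ : 1 ≤ s₀) (h₁ : s₀ < s₁)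
    (h₀' : 1 ≤ t₀) (h₁' : t₀ < t₁) (hlo : s₀ < t₀) (hhi : t₁ < s₁) :
    IsStrictHorizontalSlab (Γ.quadCell j t₀ t₁ h₀' h₁') (Γ.quadCell j s₀ s₁ h₀ h₁) := by
  have hmem : ∀ p : Square, level t₀ t₁ p ∈ Icc s₀ s₁ := fun p =>
    ⟨hlo.le.trans (level_ge h₁' p), (level_le h₁' p).trans hhi.le⟩
  have key : ∀ p : Square, (Γ.quadCell j t₀ t₁ h₀' h₁').param p
      = (Γ.quadCell j s₀ s₁ h₀ h₁).param (squarePoint s₀ s₁ (level t₀ t₁ p) p.1) := by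
    intro p
    refine (Γ.quadParam_hasStripCoords j h₀' h₁' p).eq ?_
    have h := Γ.quadParam_hasStripCoords j h₀ h₁ (squarePoint s₀ s₁ (level t₀ t₁ p) p.1)
    rwa [level_squarePoint h₁ (hmem p), squarePoint_fst p.1.2] at h
  refine ⟨⟨?_, .inl ⟨?_, ?_⟩⟩, ?_⟩
  · rintro _ ⟨p, rfl⟩
    exact ⟨_, (key p).symm⟩
  · rintro _ ⟨p, hp, rfl⟩
    exact ⟨_, (squarePoint_fst p.1.2).trans hp, (key p).symm⟩
  · rintro _ ⟨p, hp, rfl⟩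
    exact ⟨_, (squarePoint_fst p.1.2).trans hp, (key p).symm⟩
  · rw [Set.disjoint_left]
    rintro _ ⟨p, rfl⟩
    have hinj := (Γ.quadCell j s₀ s₁ h₀ h₁).injective_param
    rw [key p, OrientedCell.horizontal, OrientedCell.base, OrientedCell.top, mem_union,
      hinj.mem_set_image, hinj.mem_set_image, mem_base_iff h₁, mem_top_iff h₁,
      level_squarePoint h₁ (hmem p)]
    rintro (h | h)
    · linarith [level_le h₁' p]
    · linarith [level_ge h₁' p]

/-- The strips of different arcs are disjoint, and the coordinates in a strip are unique. -/
lemma HasStripCoords.unique {Γ : CircularPolygon k} {i j : ZMod k} {s u s' u' : ℝ} {p : Phase}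
    (h : Γ.HasStripCoords i s u p) (h' : Γ.HasStripCoords j s' u' p) (hs : 1 ≤ s) (hu : 0 ≤ u)
    (hs' : 1 ≤ s') (hu' : 0 ≤ u') : i = j ∧ s = s' := by
  have hi := Γ.δ_pos i
  have hj := Γ.δ_pos j
  have e : 2 * Γ.stripAngle i s u * (s + u) = Γ.δ i := by
    have : 0 < s + u := by linarith
    unfold stripAngle; field_simp
  have e' : 2 * Γ.stripAngle j s' u' * (s' + u') = Γ.δ j := by
    have : 0 < s' + u' := by linarith
    unfold stripAngle; field_simp
  have hθ : Γ.stripAngle i s u = Γ.stripAngle j s' u' := h.2.symm.trans h'.2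
  have hpos : 0 < Γ.stripAngle j s' u' := div_pos hj (by linarith)
  have h1 := h.1
  have h1' := h'.1
  rw [hθ] at e h1
  generalize Γ.stripAngle j s' u' = θ at *
  obtain ⟨rfl, ht⟩ := Γ.arc_coord_unique (by positivity) (by nlinarith) (by positivity)
    (by nlinarith) (h1.symm.trans h1')
  refine ⟨rfl, ?_⟩
  have : 2 * θ * s = 2 * θ * s' := by linarith
  exact mul_left_cancel₀ (by positivity) this

/-- The image of a point strictly inside a half of a fundamental quadrilateral is off the extended
singularity set. -/
lemma IsLarge.iterate_notMem_extendedSingularSet {Γ : CircularPolygon k} {j : ZMod k} {n : ℕ}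
    (hn : Γ.IsLarge j n) {ς : Half} {s u : ℝ} (hlo : ς.lo n < s) (hhi : s < ς.hi n)
    (hu : u ∈ Icc (0 : ℝ) 1) {p : Phase} (hp : Γ.HasStripCoords j s u p) :
    Γ.billiardMap^[n] p ∉ Γ.extendedSingularSet := by
  have a1 := Half.le_lo n ς
  have a2 := Half.hi_le n ς
  have hs : s ∈ Icc ((n : ℝ) - 1) n := ⟨by linarith, by linarith⟩
  have hθ := hn.stripAngle_pos hs hu
  have hx0 : Γ.nodeOffset j n s u ≠ 0 := by
    refine mul_ne_zero hθ.ne' ?_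
    cases ς <;> simp only [Half.lo, Half.hi] at hlo hhi
    · exact (by linarith : 2 * ((n : ℝ) - s) - 1 < 0).ne
    · exact (by linarith : 0 < 2 * ((n : ℝ) - s) - 1).ne'
  have hx : |Γ.nodeOffset j n s u| < Γ.stripAngle j s u := by
    rw [nodeOffset, abs_mul, abs_of_pos hθ]
    have : |2 * ((n : ℝ) - s) - 1| < 1 := abs_lt.2 ⟨by linarith, by linarith⟩
    nlinarith
  have hlt : |Γ.nodeOffset j n s u| < Γ.outAngle j n s u :=
    abs_lt_crossAngle (Γ.μ_pos j) hx.le hθ (Γ.angleBound_pos j) (min_le_right _ _)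
      (hn.stripAngle_small hs hu) hx
  obtain ⟨h1, h2⟩ := hn.iterate_hasStripCoords hs hu hp
  rw [hn.stripAngle_out hs hu, hn.two_mul_outAngle_mul_outU hs hu] at h1
  rw [hn.stripAngle_out hs hu] at h2
  have ho := hn.outAngle_pos hs hu
  have ho' : Γ.outAngle j n s u ≤ Γ.δ (j + 1) / 2 :=
    (hn.outAngle_le hs hu).trans (min_le_left _ _)
  generalize Γ.nodeOffset j n s u = x at *
  generalize Γ.outAngle j n s u = θ' at *
  obtain ⟨l1, l2⟩ := abs_lt.1 hlt
  -- `t = x + θ'` is the coordinate on the arc `j + 1`; it is none of `0`, `θ'`, `2θ'`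
  have arc : ∀ (i : ZMod k) (t : ℝ), 0 ≤ t → t ≤ Γ.δ i →
      (Γ.billiardMap^[n] p).1 = Γ.a i + (t : Real.Angle) → x + θ' = t := by
    intro i t ht0 ht1 ht
    rcases ht1.eq_or_lt with h | h
    · rw [h, ← Γ.a_succ, ← add_zero (Γ.a (i + 1)), ← Real.Angle.coe_zero, h1] at ht
      have := (Γ.arc_coord_unique (by linarith) (by linarith) le_rfl (Γ.δ_pos _) ht).2
      linarith
    · exact (Γ.arc_coord_unique (by linarith) (by linarith) ht0 h (h1.symm.trans ht)).2
  rw [extendedSingularSet, mem_iUnion]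
  rintro ⟨i, (h | ⟨h, h'⟩) | ⟨h, h'⟩⟩
  · have := arc i 0 le_rfl (Γ.δ_pos i).le (by rw [Real.Angle.coe_zero, add_zero]; exact h)
    linarith
  · have := arc i _ (by rw [h2]; linarith) h' h
    rw [h2] at this
    exact hx0 (by linarith)
  · have := arc i _ (by rw [h2]; linarith) h' h
    rw [h2] at this
    linarith

end CircularPolygon

end CircularBilliard

theorem mainTheorem9 {k : ℕ} [NeZero k] (Γ : CircularPolygon k) :
    ∃ χ₀ : ZMod k → ℕ, ∀ (χ : ZMod k → ℕ) (hχ : ∀ j, 2 ≤ χ j) (_ : ∀ j, χ₀ j ≤ χ j),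
      (∀ (j : ZMod k) (n n' : ℕ) (h : (n, n') ∈ Γ.Upsilon χ j) (ς ς' : Half),
        Stretches (Γ.billiardMap^[n])
          (Γ.fundQuad j n ((hχ j).trans h.2.2.1) ς)
          (Γ.fundQuad (j + 1) n' ((hχ (j + 1)).trans h.2.2.2) ς')) ∧
      ∃ K : ZMod k → ℕ → Half → OrientedCell,
        (∀ (j : ZMod k) (n : ℕ) (hn : χ j ≤ n) (ς : Half),
          IsStrictHorizontalSlab (K j n ς) (Γ.fundQuad j n ((hχ j).trans hn) ς)) ∧
        (∀ (i j : ZMod k) (m n : ℕ) (ς ς' : Half), χ i ≤ m → χ j ≤ n → (i, m, ς) ≠ (j, n, ς') →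
          Disjoint (K i m ς).carrier (K j n ς').carrier) ∧
        ∀ (j : ZMod k) (n n' : ℕ), (n, n') ∈ Γ.Xi χ j → ∀ ς ς' : Half,
          Stretches (Γ.billiardMap^[n]) (K j n ς) (K (j + 1) n' ς') ∧
          (Γ.billiardMap^[n] '' (K j n ς).carrier) ∩ (K (j + 1) n' ς').carrier ∩
            Γ.extendedSingularSet = ∅ := by
  choose χ₀ hχ₀ using Γ.exists_isLarge
  refine ⟨χ₀, fun χ hχ hle => ⟨fun j n n' h ς ς' => ?_, ?_⟩⟩
  · exact (hχ₀ j n ((hle j).trans h.2.2.1)).stretches_fundQuad _ h.1 h.2.1 ς ς'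
  have hlarge : ∀ j n, χ j ≤ n → Γ.IsLarge j n := fun j n h => hχ₀ j n ((hle j).trans h)
  choose! ε hε using fun j n (h : χ j ≤ n) => (hlarge j n h).exists_shrink
  have hlo : ∀ j n (_ : χ j ≤ n) (ς : Half), 1 ≤ ς.lo n + ε j n := fun j n h ς => by
    linarith [(hlarge j n h).one_le_sub_one, Half.le_lo n ς, (hε j n h).1]
  have hlt : ∀ j n (_ : χ j ≤ n) (ς : Half), ς.lo n + ε j n < ς.hi n - ε j n := fun j n h ς => by
    linarith [(hε j n h).2.1, Half.hi_eq n ς]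
  -- the value of `K` for indices below `χ` is irrelevant
  let K : ZMod k → ℕ → Half → OrientedCell := fun j n ς =>
    if h : χ j ≤ n then
      Γ.quadCell j (ς.lo n + ε j n) (ς.hi n - ε j n) (hlo j n h ς) (hlt j n h ς)
    else Γ.fundQuad j 2 le_rfl ς
  have hK : ∀ j n (h : χ j ≤ n) (ς : Half), K j n ς =
      Γ.quadCell j (ς.lo n + ε j n) (ς.hi n - ε j n) (hlo j n h ς) (hlt j n h ς) :=
    fun j n h ς => dif_pos h
  have hcoords : ∀ j n (_ : χ j ≤ n) (ς : Half), ∀ p ∈ (K j n ς).carrier,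
      ∃ s u, ς.lo n < s ∧ s < ς.hi n ∧ u ∈ Icc (0 : ℝ) 1 ∧ Γ.HasStripCoords j s u p := by
    intro j n h ς p hp
    rw [hK j n h ς] at hp
    obtain ⟨q, rfl⟩ := hp
    have h0 := (hε j n h).1
    exact ⟨_, q.1, by linarith [CircularPolygon.level_ge (hlt j n h ς) q],
      by linarith [CircularPolygon.level_le (hlt j n h ς) q], q.1.2,
      Γ.quadParam_hasStripCoords j (hlo j n h ς) (hlt j n h ς) q⟩
  refine ⟨K, fun j n hn ς => ?_, ?_, fun j n n' h ς ς' => ⟨?_, ?_⟩⟩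
  · have h0 := (hε j n hn).1
    have h1 := (hlarge j n hn).one_le_sub_one
    rw [hK j n hn ς, Γ.fundQuad_eq j n ((hχ j).trans hn) ς (by linarith [Half.le_lo n ς])
      (by linarith [Half.hi_eq n ς])]
    exact Γ.quadCell_isStrictHorizontalSlab j _ _ _ _ (by linarith) (by linarith)
  · intro i j m n ς ς' hm hn hne
    rw [Set.disjoint_left]
    intro p hp hp'
    obtain ⟨s, u, h1, h2, hu, hc⟩ := hcoords i m hm ς p hp
    obtain ⟨s', u', h1', h2', hu', hc'⟩ := hcoords j n hn ς' p hp'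
    have g := (hlarge i m hm).one_le_sub_one
    have g' := (hlarge j n hn).one_le_sub_one
    obtain ⟨rfl, rfl⟩ := hc.unique hc' (by linarith [Half.le_lo m ς]) hu.1
      (by linarith [Half.le_lo n ς']) hu'.1
    obtain ⟨rfl, rfl⟩ := Half.eq_of_level h1 h2 h1' h2'
    exact hne rfl
  · have h0 := (hε j n h.2.2.1).1
    have h0' := (hε (j + 1) n' h.2.2.2).1
    rw [hK j n h.2.2.1 ς, hK (j + 1) n' h.2.2.2 ς']
    refine (hlarge j n h.2.2.1).stretches _ _ _ _ (by linarith [Half.le_lo n ς])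
      (by linarith [Half.hi_le n ς]) ?_
    have b1 := Half.le_lo n' ς'
    have b2 := Half.hi_le n' ς'
    rcases (hε j n h.2.2.1).2.2 n' h.1 h.2.1 ς with H | H
    · exact .inl fun u hu => ⟨by linarith [(H u hu).1], by linarith [(H u hu).2]⟩
    · exact .inr fun u hu => ⟨by linarith [(H u hu).1], by linarith [(H u hu).2]⟩
  · rw [Set.eq_empty_iff_forall_notMem]
    rintro _ ⟨⟨⟨p, hp, rfl⟩, -⟩, hL⟩
    obtain ⟨s, u, h1, h2, hu, hc⟩ := hcoords j n h.2.2.1 ς p hp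
    exact (hlarge j n h.2.2.1).iterate_notMem_extendedSingularSet h1 h2 hu hc hL
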